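/- A semidiversity on $\mathbb{R}^k$ is a function $\delta \ge 0$ on the finite subsets of $\mathbb{R}^k$ with $\delta(A)=0$ whenever $|A|\le 1$ and $\delta(A\cup C)\le \delta(A\cup B)+\delta(B\cup C)$ whenever $B\neq\emptyset$. It is linear if $\delta(\lambda A)=\lambda\,\delta(A)$ and $\delta(A+B)=\delta(A)+\delta(B)$ (Minkowski sum) for all $\lambda\ge 0$ and nonempty finite $A,B\subseteq\mathbb{R}^k$. A nonzero linear semidiversity $\delta$ is extremal in the cone of linear semidiversities if, whenever $\delta=t\delta_1+(1-t)\delta_2$ with $0<t<1$ and linear semidiversities $\delta_1,\delta_2$, both $\delta_1$ and $\delta_2$ are nonnegative multiples of $\delta$. For a nonempty finite set $A$ let $h_A(x)=\max\{a\cdot x: a\in A\}$ be its support function. For a closed convex set $K\subseteq\mathbb{R}^k$ with nonempty interior (not necessarily bounded), the Minkowski semidiversity with kernel $K$ is $\delta_K(A)=\inf\{\lambda\ge 0: A\subseteq \lambda K+x \text{ for some } x\in\mathbb{R}^k\}$ for finite $A$. **Theorem.** Let $\delta$ be a semidiversity on $\mathbb{R}^k$ that is not identically zero. The following are equivalent: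 (i) $\delta$ is extremal in the cone of linear semidiversities on $\mathbb{R}^k$. (ii) There is a finite (positive) Borel measure $\nu$ on the unit sphere $\mathbb{S}^{k-1}$ with $\int_{\mathbb{S}^{k-1}} x\,\mathrm{d}\nu(x)=0$, whose support is a finite, affinely independent set, such that $\delta(A)=\int_{\mathbb{S}^{k-1}} h_A(x)\,\mathrm{d}\nu(x)$ for all nonempty finite $A\subseteq\mathbb{R}^k$. (iii) There is an affinely independent set $W\subseteq\mathbb{R}^k$ such that $\delta=\delta_K$ is the Minkowski semidiversity with kernel $K=\mathrm{conv}(W)+H^{\perp}$, where $H$ is the affine hull of $W$ and $H^{\perp}$ is the orthogonal complement of the linear subspace parallel to $H$. -/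

import Mathlib

open scoped Pointwise

noncomputable section

namespace LinearDiversity

/-- `ℝ^k` with its usual dot product and Euclidean norm. -/
abbrev Space (k : ℕ) : Type := EuclideanSpace ℝ (Fin k)

/-- The unit sphere of `ℝ^k`, as a type. -/
abbrev UnitSphere (k : ℕ) : Type := Metric.sphere (0 : Space k) 1

open Classical in
/-- `(X, δ)` is a semidiversity: `δ` is a nonnegative function on the finite subsets of `X` that
vanishes on sets with at most one point and satisfies the triangle inequality
`δ (A ∪ C) ≤ δ (A ∪ B) + δ (B ∪ C)` for nonempty `B`. -/
structure IsSemidiversity {X : Type*} (δ : Finset X → ℝ) : Prop where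
  nonneg : ∀ A : Finset X, 0 ≤ δ A
  eq_zero_of_card_le_one : ∀ A : Finset X, A.card ≤ 1 → δ A = 0
  triangle : ∀ A B C : Finset X, B.Nonempty → δ (A ∪ C) ≤ δ (A ∪ B) + δ (B ∪ C)

open Classical in
/-- `δ` is (Minkowski) linear: `δ (c A) = c δ A` and `δ (A + B) = δ A + δ B` for `c ≥ 0` and
nonempty finite `A`, `B` (with `A + B` and `c A` the Minkowski sum and the dilate). -/
structure IsMinkowskiLinear {k : ℕ} (δ : Finset (Space k) → ℝ) : Prop where
  map_smul : ∀ (c : ℝ) (A : Finset (Space k)), 0 ≤ c → A.Nonempty → δ (c • A) = c * δ A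
  map_add : ∀ A B : Finset (Space k), A.Nonempty → B.Nonempty → δ (A + B) = δ A + δ B

/-- Linear semidiversities on `ℝ^k`. -/
structure IsLinearSemidiversity {k : ℕ} (δ : Finset (Space k) → ℝ) : Prop where
  semidiversity : IsSemidiversity δ
  linear : IsMinkowskiLinear δ

/-- `ε` is a scale copy of `δ`. -/
def IsScaleCopy {X : Type*} (ε δ : Finset X → ℝ) : Prop :=
  ∃ c : ℝ, 0 ≤ c ∧ ε = c • δ

/-- `δ` spans an extremal ray of the cone of linear semidiversities on `ℝ^k`: it is a nonzero
linear semidiversity, and whenever it is a proper convex combination of two linear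
semidiversities, these are scale copies of `δ`. -/
structure IsExtremalLinear {k : ℕ} (δ : Finset (Space k) → ℝ) : Prop where
  isLinearSemidiversity : IsLinearSemidiversity δ
  ne_zero : δ ≠ 0
  extremal : ∀ (δ₁ δ₂ : Finset (Space k) → ℝ) (t : ℝ),
    IsLinearSemidiversity δ₁ → IsLinearSemidiversity δ₂ → 0 < t → t < 1 →
    δ = t • δ₁ + (1 - t) • δ₂ → IsScaleCopy δ₁ δ ∧ IsScaleCopy δ₂ δ

/-- The support function `h_A (x) = sup {a · x : a ∈ A}` of a (nonempty bounded) set `A`. -/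
def supportFun {k : ℕ} (A : Set (Space k)) (x : Space k) : ℝ :=
  sSup ((fun a : Space k => inner ℝ a x) '' A)

/-- `ν` represents `δ`: the centroid of `ν` is the origin, and `δ A` is the integral over the unit
sphere of the support function of `A`, for every (nonempty) finite `A`. -/
structure Represents {k : ℕ} (ν : MeasureTheory.Measure (UnitSphere k))
    (δ : Finset (Space k) → ℝ) : Prop where
  centroid_eq_zero : ∫ x, (x : Space k) ∂ν = 0
  eq_integral : ∀ A : Finset (Space k), A.Nonempty →
    δ A = ∫ x, supportFun (A : Set (Space k)) (x : Space k) ∂ν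

/-- The support of a measure on the unit sphere, as a subset of `ℝ^k`. -/
def supportSet {k : ℕ} (ν : MeasureTheory.Measure (UnitSphere k)) : Set (Space k) :=
  Subtype.val '' ν.support

/-- The set `W` of points is affinely independent. -/
def IsAffinelyIndependentSet {k : ℕ} (W : Set (Space k)) : Prop :=
  AffineIndependent ℝ (Subtype.val : W → Space k)

/-- The generalized circumradius `inf {r ≥ 0 : A ⊆ r K + x for some x}`. -/
def genCircumradius {k : ℕ} (K A : Set (Space k)) : ℝ :=
  sInf {r : ℝ | 0 ≤ r ∧ ∃ x : Space k, A ⊆ r • K + {x}}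

/-- `δ` is the Minkowski semidiversity with kernel `K`, where kernels are closed convex sets with
nonempty interior (possibly unbounded). -/
structure IsMinkowskiSemidiversity {k : ℕ} (K : Set (Space k))
    (δ : Finset (Space k) → ℝ) : Prop where
  isClosed : IsClosed K
  convex : Convex ℝ K
  interior_nonempty : (interior K).Nonempty
  eq_genCircumradius : ∀ A : Finset (Space k), δ A = genCircumradius K (A : Set (Space k))

/-- `conv W + H^⊥`, where `H^⊥` is the orthogonal complement of (the direction of) the affine
hull `H` of `W`. -/
def simplexKernel {k : ℕ} (W : Set (Space k)) : Set (Space k) :=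
  convexHull ℝ W + (((affineSpan ℝ W).directionᗮ : Submodule ℝ (Space k)) : Set (Space k))

end LinearDiversity

end

namespace LinearDiversity

open MeasureTheory

section Classical

open Classical

variable {k : ℕ}

/-! ### Support functions of finite sets -/

/-! Linear semidiversities correspond to finite centred measures on the sphere, and extremality is
decided on the measure side. A linear semidiversity is monotone for inclusion of convex hulls
(`le_of_subset_convexHull`), hence is a positive linear functional of support functions. Their
differences form a vector lattice that is dense in the continuous functions on the sphere, so Riesz
extension and Riesz–Markov give a representing measure (`exists_represents`). Density makes it
unique, and vanishing on singletons puts its centroid at the origin. If `ν` represents an extremal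
`δ`, no nonzero bounded density `g` can have zero mass and zero first moment, since `(1 ± g)ν` after
scaling would split `δ`. These are `k + 1` linear conditions, so the support is finite, and then
affinely independent. Conversely, on a finite affinely independent set a centred measure is unique
up to scale. For the kernels, let `u i` be the atoms of `ν` scaled by their masses; they sum to zero
and are facet normals of a simplex `K` with offsets `b i` of sum one. The set `A` fits in `r • K +
x` exactly when `h_A (u i) ≤ r * b i + ⟪u i, x⟫` for all `i`. Summing gives `∑ i, h_A (u i) ≤ r`,
and a suitable `x` attains this bound up to `ε` (`genCircumradius_eq_sum`). -/

theorem supportFun_eq_sup' {A : Finset (Space k)} (hA : A.Nonempty) (x : Space k) :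
    supportFun (A : Set (Space k)) x = A.sup' hA fun a => inner ℝ a x := by
  rw [supportFun, Finset.sup'_eq_csSup_image]

theorem supportFun_le_iff {A : Finset (Space k)} (hA : A.Nonempty) {x : Space k} {r : ℝ} :
    supportFun (A : Set (Space k)) x ≤ r ↔ ∀ a ∈ A, inner ℝ a x ≤ r := by
  rw [supportFun_eq_sup' hA, Finset.sup'_le_iff]

theorem inner_le_supportFun {A : Finset (Space k)} {a : Space k} (ha : a ∈ A) (x : Space k) :
    inner ℝ a x ≤ supportFun (A : Set (Space k)) x :=
  (supportFun_le_iff ⟨a, ha⟩).1 le_rfl a ha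

theorem exists_supportFun_eq {A : Finset (Space k)} (hA : A.Nonempty) (x : Space k) :
    ∃ a ∈ A, supportFun (A : Set (Space k)) x = inner ℝ a x := by
  rw [supportFun_eq_sup' hA]
  exact Finset.exists_mem_eq_sup' hA _

@[simp]
theorem supportFun_singleton (a x : Space k) :
    supportFun ({a} : Set (Space k)) x = inner ℝ a x := by
  simp [supportFun]

theorem supportFun_add {A B : Finset (Space k)} (hA : A.Nonempty) (hB : B.Nonempty)
    (x : Space k) :
    supportFun ((A + B : Finset (Space k)) : Set (Space k)) x =
      supportFun (A : Set (Space k)) x + supportFun (B : Set (Space k)) x := by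
  apply le_antisymm
  · rw [supportFun_le_iff (hA.add hB)]
    intro c hc
    obtain ⟨a, ha, b, hb, rfl⟩ := Finset.mem_add.1 hc
    rw [inner_add_left]
    exact add_le_add (inner_le_supportFun ha x) (inner_le_supportFun hb x)
  · obtain ⟨a, ha, h1⟩ := exists_supportFun_eq hA x
    obtain ⟨b, hb, h2⟩ := exists_supportFun_eq hB x
    rw [h1, h2, ← inner_add_left]
    exact inner_le_supportFun (Finset.add_mem_add ha hb) x

theorem supportFun_smul {A : Finset (Space k)} (hA : A.Nonempty) {c : ℝ} (hc : 0 ≤ c)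
    (x : Space k) :
    supportFun ((c • A : Finset (Space k)) : Set (Space k)) x =
      c * supportFun (A : Set (Space k)) x := by
  apply le_antisymm
  · rw [supportFun_le_iff hA.smul_finset]
    intro y hy
    obtain ⟨a, ha, rfl⟩ := Finset.mem_smul_finset.1 hy
    rw [real_inner_smul_left]
    exact mul_le_mul_of_nonneg_left (inner_le_supportFun ha x) hc
  · obtain ⟨a, ha, h1⟩ := exists_supportFun_eq hA x
    rw [h1, ← real_inner_smul_left]
    exact inner_le_supportFun (Finset.smul_mem_smul_finset ha) x

theorem supportFun_union {A B : Finset (Space k)} (hA : A.Nonempty) (hB : B.Nonempty)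
    (x : Space k) :
    supportFun ((A ∪ B : Finset (Space k)) : Set (Space k)) x =
      supportFun (A : Set (Space k)) x ⊔ supportFun (B : Set (Space k)) x := by
  rw [supportFun_eq_sup' hA, supportFun_eq_sup' hB, supportFun_eq_sup' hA.inl,
    Finset.sup'_union hA hB]

theorem supportFun_smul_right {A : Finset (Space k)} (hA : A.Nonempty) {c : ℝ} (hc : 0 ≤ c)
    (x : Space k) :
    supportFun (A : Set (Space k)) (c • x) = c * supportFun (A : Set (Space k)) x := by
  apply le_antisymm
  · rw [supportFun_le_iff hA]
    intro a ha
    rw [real_inner_smul_right]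
    exact mul_le_mul_of_nonneg_left (inner_le_supportFun ha x) hc
  · obtain ⟨a, ha, h1⟩ := exists_supportFun_eq hA x
    rw [h1, ← real_inner_smul_right]
    exact inner_le_supportFun ha _

theorem continuous_supportFun {A : Finset (Space k)} (hA : A.Nonempty) :
    Continuous (supportFun (A : Set (Space k))) := by
  have : supportFun (A : Set (Space k)) = fun x => A.sup' hA fun a => inner ℝ a x :=
    funext fun x => supportFun_eq_sup' hA x
  rw [this]
  exact Continuous.finset_sup'_apply hA fun a _ => by fun_prop

/-- A finite set lies in the convex hull of another one if its support function is smaller. -/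
theorem subset_convexHull_of_supportFun_le {A B : Finset (Space k)} (hB : B.Nonempty)
    (h : ∀ x : UnitSphere k,
      supportFun (A : Set (Space k)) (x : Space k) ≤ supportFun (B : Set (Space k)) x) :
    (A : Set (Space k)) ⊆ convexHull ℝ (B : Set (Space k)) := by
  intro a ha
  by_contra hn
  obtain ⟨f, u, hf, hu⟩ := geometric_hahn_banach_closed_point (convex_convexHull ℝ _)
    (B.finite_toSet.isClosed_convexHull ℝ) hn
  set g := (InnerProductSpace.toDual ℝ (Space k)).symm f with hg
  have hfg : ∀ y, f y = inner ℝ y g := fun y => by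
    rw [real_inner_comm, hg, InnerProductSpace.toDual_symm_apply]
  obtain ⟨b, hb⟩ := hB
  have hg0 : g ≠ 0 := by
    intro h0
    have h1 := hf b (subset_convexHull ℝ _ hb)
    simp only [hfg, h0, inner_zero_right] at h1 hu
    linarith
  have hn0 : 0 < ‖g‖ := norm_pos_iff.2 hg0
  have hx : ‖g‖⁻¹ • g ∈ Metric.sphere (0 : Space k) 1 := by
    simp [norm_smul, hn0.ne']
  have h2 := h ⟨_, hx⟩
  simp only at h2
  rw [supportFun_smul_right ⟨a, ha⟩ (by positivity), supportFun_smul_right ⟨b, hb⟩ (by positivity)]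
    at h2
  have h3 := le_of_mul_le_mul_left h2 (by positivity)
  obtain ⟨b', hb', hb'2⟩ := exists_supportFun_eq ⟨b, hb⟩ g
  have h4 := inner_le_supportFun (Finset.mem_coe.1 ha) g
  have h5 := hf b' (subset_convexHull ℝ _ hb')
  rw [hfg] at h5 hu
  linarith

/-! ### Linear semidiversities only see convex hulls -/

theorem IsSemidiversity.apply_empty {X : Type*} {δ : Finset X → ℝ} (hδ : IsSemidiversity δ) :
    δ ∅ = 0 :=
  hδ.eq_zero_of_card_le_one _ (by simp)

theorem IsSemidiversity.apply_singleton {X : Type*} {δ : Finset X → ℝ} (hδ : IsSemidiversity δ)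
    (a : X) : δ {a} = 0 :=
  hδ.eq_zero_of_card_le_one _ (by simp)

theorem IsSemidiversity.apply_union_le {X : Type*} [DecidableEq X] {δ : Finset X → ℝ}
    (hδ : IsSemidiversity δ) (A : Finset X) {B : Finset X} (C : Finset X) (hB : B.Nonempty) :
    δ (A ∪ C) ≤ δ (A ∪ B) + δ (B ∪ C) := by
  convert hδ.triangle A B C hB

theorem IsSemidiversity.le_insert {X : Type*} [DecidableEq X] {δ : Finset X → ℝ}
    (hδ : IsSemidiversity δ) (a : X) (A : Finset X) : δ A ≤ δ (insert a A) := by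
  have h := hδ.apply_union_le A (B := {a}) ∅ (by simp)
  rwa [Finset.union_empty, Finset.union_empty, hδ.apply_singleton, add_zero, Finset.union_comm,
    ← Finset.insert_eq] at h

theorem IsSemidiversity.mono {X : Type*} {δ : Finset X → ℝ} (hδ : IsSemidiversity δ)
    {A B : Finset X} (h : A ⊆ B) : δ A ≤ δ B := by
  have : ∀ C : Finset X, δ A ≤ δ (C ∪ A) := by
    intro C
    induction C using Finset.induction_on with
    | empty => simp
    | insert c C _ ih => exact ih.trans (by rw [Finset.insert_union]; exact hδ.le_insert _ _)
  simpa [Finset.union_eq_left.2 h] using this B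

namespace IsLinearSemidiversity

variable {δ : Finset (Space k) → ℝ}

/-- The pair is a translate of `t • {0, y - x}` with `t ≤ 1`. The bound is uniform along the
segment, which starts the halving argument below. -/
theorem apply_pair_le (hδ : IsLinearSemidiversity δ) {x y p : Space k}
    (hp : p ∈ segment ℝ x y) : δ {x, p} ≤ δ {0, y - x} := by
  rw [segment_eq_image'] at hp
  obtain ⟨t, ⟨ht0, ht1⟩, rfl⟩ := hp
  have h : ({x, x + t • (y - x)} : Finset (Space k)) =
      {x} + t • ({0, y - x} : Finset (Space k)) := by
    ext z
    simp [Finset.mem_add, Finset.mem_smul_finset, eq_comm]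
  rw [h, hδ.linear.map_add _ _ (by simp) (by simp), hδ.linear.map_smul _ _ ht0 (by simp),
    hδ.semidiversity.apply_singleton, zero_add]
  exact mul_le_of_le_one_left (hδ.semidiversity.nonneg _) ht1

/-- Reflecting the endpoint `z` nearer to `p` through `p` gives `q` on the segment with `2p = z +
q`. Then `2 (C ∪ {p}) ⊆ C + (C ∪ {q})`, so the excess over `δ C` at `p` is at most half the excess
at `q`. -/
theorem apply_insert_le_half (hδ : IsLinearSemidiversity δ) {C : Finset (Space k)}
    {x y p : Space k} (hx : x ∈ C) (hy : y ∈ C) (hp : p ∈ segment ℝ x y) :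
    ∃ q ∈ segment ℝ x y, 2 * δ (insert p C) ≤ δ C + δ (insert q C) := by
  have key : ∀ z ∈ C, ∀ q, (2 : ℝ) • p = z + q → 2 * δ (insert p C) ≤ δ C + δ (insert q C) := by
    intro z hz q hq
    rw [← hδ.linear.map_smul 2 _ (by norm_num) (by simp),
      ← hδ.linear.map_add C _ ⟨x, hx⟩ (by simp)]
    apply hδ.semidiversity.mono
    intro w hw
    obtain ⟨v, hv, rfl⟩ := Finset.mem_smul_finset.1 hw
    rcases Finset.mem_insert.1 hv with rfl | hv
    · rw [hq]
      exact Finset.add_mem_add hz (by simp)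
    · rw [two_smul]
      exact Finset.add_mem_add hv (by simp [hv])
  obtain ⟨a, b, ha, hb, hab, rfl⟩ := hp
  rcases le_total (1 / 2) a with h | h
  · refine ⟨(2 * a - 1) • x + (2 * b) • y, ⟨_, _, by linarith, by linarith, by linarith, rfl⟩,
      key x hx _ (by module)⟩
  · refine ⟨(2 * a) • x + (2 * b - 1) • y, ⟨_, _, by linarith, by linarith, by linarith, rfl⟩,
      key y hy _ (by module)⟩

theorem apply_insert_of_mem_segment (hδ : IsLinearSemidiversity δ) {C : Finset (Space k)}
    {x y p : Space k} (hx : x ∈ C) (hy : y ∈ C) (hp : p ∈ segment ℝ x y) :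
    δ (insert p C) = δ C := by
  have h : ∀ n : ℕ, ∀ p ∈ segment ℝ x y,
      δ (insert p C) - δ C ≤ δ {0, y - x} * (1 / 2 : ℝ) ^ n := by
    intro n
    induction n with
    | zero =>
      intro p hp
      have h1 := hδ.semidiversity.apply_union_le C (B := {x}) {p} (by simp)
      rw [Finset.union_eq_left.2 (Finset.singleton_subset_iff.2 hx), Finset.union_comm C,
        ← Finset.insert_eq, ← Finset.insert_eq] at h1
      have h2 := hδ.apply_pair_le hp
      rw [pow_zero, mul_one]
      linarith
    | succ n ih =>
      intro p hp
      obtain ⟨q, hq, h1⟩ := hδ.apply_insert_le_half hx hy hp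
      have h2 := ih q hq
      rw [pow_succ]
      linarith
  apply le_antisymm _ (hδ.semidiversity.le_insert _ _)
  have h0 : Filter.Tendsto (fun n : ℕ => δ {0, y - x} * (1 / 2 : ℝ) ^ n) Filter.atTop (nhds 0) := by
    simpa using (tendsto_pow_atTop_nhds_zero_of_lt_one (r := (1 / 2 : ℝ)) (by norm_num)
      (by norm_num)).const_mul (δ {0, y - x})
  have := ge_of_tendsto' h0 fun n => h n p hp
  linarith

theorem apply_insert_of_mem_convexHull (hδ : IsLinearSemidiversity δ) {B C : Finset (Space k)}
    (hBC : B ⊆ C) {a : Space k} (ha : a ∈ convexHull ℝ (B : Set (Space k))) :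
    δ (insert a C) = δ C := by
  -- Quantifying over all `C ⊇ B` makes this set convex: for `p` between `x` and `y`, both endpoints
  -- can first be added to `C` at no cost.
  have h : convexHull ℝ (B : Set (Space k)) ⊆
      {a | ∀ C : Finset (Space k), B ⊆ C → δ (insert a C) = δ C} := by
    apply convexHull_min
    · intro b hb C hC
      rw [Finset.insert_eq_of_mem (hC hb)]
    · rw [convex_iff_segment_subset]
      intro x hx y hy p hp C hC
      apply le_antisymm _ (hδ.semidiversity.le_insert _ _)
      calc δ (insert p C) ≤ δ (insert p (insert y (insert x C))) :=
            hδ.semidiversity.mono (Finset.insert_subset_insert _ fun z hz => by simp [hz])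
        _ = δ (insert y (insert x C)) :=
            hδ.apply_insert_of_mem_segment (by simp) (by simp) hp
        _ = δ (insert x C) := hy _ fun z hz => by simp [hC hz]
        _ = δ C := hx _ hC
  exact h ha C hBC

theorem le_of_subset_convexHull (hδ : IsLinearSemidiversity δ) {A B : Finset (Space k)}
    (h : (A : Set (Space k)) ⊆ convexHull ℝ (B : Set (Space k))) : δ A ≤ δ B := by
  have key : ∀ C : Finset (Space k), C ⊆ A → δ (C ∪ B) = δ B := by
    intro C
    induction C using Finset.induction_on with
    | empty => simp
    | insert c C _ ih =>
      intro hC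
      rw [Finset.insert_union, hδ.apply_insert_of_mem_convexHull Finset.subset_union_right
        (h (hC (Finset.mem_insert_self _ _))), ih fun z hz => hC (by simp [hz])]
  rw [← key A subset_rfl]
  exact hδ.semidiversity.mono Finset.subset_union_left

theorem le_of_supportFun_le (hδ : IsLinearSemidiversity δ) {A B : Finset (Space k)}
    (hB : B.Nonempty) (h : ∀ x : UnitSphere k,
      supportFun (A : Set (Space k)) (x : Space k) ≤ supportFun (B : Set (Space k)) x) :
    δ A ≤ δ B :=
  hδ.le_of_subset_convexHull (subset_convexHull_of_supportFun_le hB h)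

end IsLinearSemidiversity

/-! ### Differences of support functions -/

/-- Differences of support functions of finite sets, restricted to the unit sphere. -/
def supportDifference (k : ℕ) : Submodule ℝ C(UnitSphere k, ℝ) where
  carrier := {f | ∃ A B : Finset (Space k), A.Nonempty ∧ B.Nonempty ∧
    ∀ x : UnitSphere k, f x =
      supportFun (A : Set (Space k)) (x : Space k) - supportFun (B : Set (Space k)) x}
  add_mem' := by
    rintro f g ⟨A, B, hA, hB, hf⟩ ⟨C, D, hC, hD, hg⟩
    refine ⟨A + C, B + D, hA.add hC, hB.add hD, fun x => ?_⟩
    rw [ContinuousMap.add_apply, hf, hg, supportFun_add hA hC, supportFun_add hB hD]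
    ring
  zero_mem' := ⟨{0}, {0}, by simp, by simp, fun x => by simp⟩
  smul_mem' := by
    rintro c f ⟨A, B, hA, hB, hf⟩
    rcases le_total 0 c with hc | hc
    · refine ⟨c • A, c • B, hA.smul_finset, hB.smul_finset, fun x => ?_⟩
      rw [ContinuousMap.smul_apply, hf, supportFun_smul hA hc, supportFun_smul hB hc, smul_eq_mul]
      ring
    · refine ⟨(-c) • B, (-c) • A, hB.smul_finset, hA.smul_finset, fun x => ?_⟩
      rw [ContinuousMap.smul_apply, hf, supportFun_smul hA (neg_nonneg.2 hc),
        supportFun_smul hB (neg_nonneg.2 hc), smul_eq_mul]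
      ring

theorem exists_mem_supportDifference_eq_supportFun {A : Finset (Space k)} (hA : A.Nonempty) :
    ∃ f ∈ supportDifference k, ∀ x : UnitSphere k,
      f x = supportFun (A : Set (Space k)) (x : Space k) :=
  ⟨⟨fun x => supportFun (A : Set (Space k)) (x : Space k),
    (continuous_supportFun hA).comp continuous_subtype_val⟩,
    ⟨A, {0}, hA, by simp, fun x => by simp⟩, fun _ => rfl⟩

/-- Over the common subtrahend `h_{B+D}`, the maximum is that of two support functions, which is the
support function of the union. -/
theorem sup_mem_supportDifference {f g : C(UnitSphere k, ℝ)} (hf : f ∈ supportDifference k)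
    (hg : g ∈ supportDifference k) : f ⊔ g ∈ supportDifference k := by
  obtain ⟨A, B, hA, hB, hf⟩ := hf
  obtain ⟨C, D, hC, hD, hg⟩ := hg
  refine ⟨(A + D) ∪ (C + B), B + D, (hA.add hD).inl, hB.add hD, fun x => ?_⟩
  rw [ContinuousMap.sup_apply, hf, hg, supportFun_union (hA.add hD) (hC.add hB),
    supportFun_add hA hD, supportFun_add hC hB, supportFun_add hB hD, ← max_sub_sub_right]
  congr 1 <;> ring

theorem inf_mem_supportDifference {f g : C(UnitSphere k, ℝ)} (hf : f ∈ supportDifference k)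
    (hg : g ∈ supportDifference k) : f ⊓ g ∈ supportDifference k := by
  have h : f ⊓ g = f + g - f ⊔ g := by
    ext x
    simp only [ContinuousMap.inf_apply, ContinuousMap.sub_apply, ContinuousMap.add_apply,
      ContinuousMap.sup_apply]
    linarith [min_add_max (f x) (g x)]
  rw [h]
  exact Submodule.sub_mem _ (Submodule.add_mem _ hf hg) (sup_mem_supportDifference hf hg)

theorem exists_mem_supportDifference_pos_zero {x y : UnitSphere k} (hxy : x ≠ y) :
    ∃ f ∈ supportDifference k, 0 < f x ∧ f y = 0 := by
  -- This is the positive part of `⟪x - y, ·⟫`, where `⟪x, y⟫ < 1` for distinct unit vectors.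
  obtain ⟨f, hf, h⟩ := exists_mem_supportDifference_eq_supportFun
    (A := {0, (x : Space k) - y}) (by simp)
  have hx : ‖(x : Space k)‖ = 1 := by simp
  have hy : ‖(y : Space k)‖ = 1 := by simp
  have hlt : inner ℝ (x : Space k) (y : Space k) < 1 := by
    refine lt_of_le_of_ne ?_ ?_
    · simpa [hx, hy] using real_inner_le_norm (x : Space k) y
    · intro h1
      exact hxy (Subtype.ext ((inner_eq_one_iff_of_norm_eq_one hx hy).1 h1))
  refine ⟨f, hf, ?_, ?_⟩
  · rw [h]
    refine lt_of_lt_of_le ?_ (inner_le_supportFun (a := (x : Space k) - (y : Space k)) (by simp) _)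
    rw [inner_sub_left, real_inner_self_eq_norm_sq, hx, real_inner_comm]
    linarith
  · rw [h]
    apply le_antisymm
    · rw [supportFun_le_iff (by simp)]
      intro a ha
      rcases Finset.mem_insert.1 ha with rfl | ha
      · simp
      · rw [Finset.mem_singleton.1 ha, inner_sub_left, real_inner_self_eq_norm_sq, hy]
        linarith
    · refine le_trans ?_ (inner_le_supportFun (a := (0 : Space k)) (by simp) _)
      simp

theorem separatesPointsStrongly_supportDifference :
    (supportDifference k : Set C(UnitSphere k, ℝ)).SeparatesPointsStrongly := by
  intro v x y
  by_cases hxy : x = y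
  · subst hxy
    obtain ⟨f, hf, h⟩ := exists_mem_supportDifference_eq_supportFun
      (A := {(x : Space k)}) (by simp)
    have hx : f x = 1 := by
      rw [h]
      simp
    exact ⟨v x • f, Submodule.smul_mem _ _ hf, by simp [hx], by simp [hx]⟩
  · obtain ⟨f, hf, hfx, hfy⟩ := exists_mem_supportDifference_pos_zero hxy
    obtain ⟨g, hg, hgy, hgx⟩ := exists_mem_supportDifference_pos_zero (Ne.symm hxy)
    refine ⟨(v x / f x) • f + (v y / g y) • g,
      Submodule.add_mem _ (Submodule.smul_mem _ _ hf) (Submodule.smul_mem _ _ hg), ?_, ?_⟩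
    · simp [hgx, hfx.ne']
    · simp [hfy, hgy.ne']

/-- This is the lattice form of Stone–Weierstrass. -/
theorem dense_supportDifference :
    Dense (supportDifference k : Set C(UnitSphere k, ℝ)) :=
  dense_iff_closure_eq.2 <| ContinuousMap.sublattice_closure_eq_top _
    ⟨0, Submodule.zero_mem _⟩ (fun _ hf _ hg => inf_mem_supportDifference hf hg)
    (fun _ hf _ hg => sup_mem_supportDifference hf hg) separatesPointsStrongly_supportDifference

/-! ### Uniqueness and existence of representing measures -/

theorem integrable_of_continuous (ν : Measure (UnitSphere k)) [IsFiniteMeasure ν]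
    {E : Type*} [NormedAddCommGroup E] {f : UnitSphere k → E} (hf : Continuous f) :
    Integrable f ν := by
  simpa using hf.continuousOn.integrableOn_compact (μ := ν) isCompact_univ

theorem integrable_supportFun (ν : Measure (UnitSphere k)) [IsFiniteMeasure ν]
    {A : Finset (Space k)} (hA : A.Nonempty) :
    Integrable (fun x : UnitSphere k => supportFun (A : Set (Space k)) (x : Space k)) ν :=
  integrable_of_continuous ν ((continuous_supportFun hA).comp continuous_subtype_val)

theorem continuous_integral_continuousMap (ν : Measure (UnitSphere k)) [IsFiniteMeasure ν] :
    Continuous fun f : C(UnitSphere k, ℝ) => ∫ x, f x ∂ν := by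
  refine LipschitzWith.continuous (K := (ν.real Set.univ).toNNReal)
    (LipschitzWith.of_dist_le_mul fun f g => ?_)
  rw [dist_eq_norm, dist_eq_norm, ← integral_sub (integrable_of_continuous ν f.continuous)
    (integrable_of_continuous ν g.continuous), Real.coe_toNNReal _ measureReal_nonneg, mul_comm]
  exact norm_integral_le_of_norm_le_const (Filter.Eventually.of_forall fun x =>
    (f - g).norm_coe_le_norm x)

/-- A finite measure on the sphere is determined by its integrals of support functions. -/
theorem measure_ext_of_integral_supportFun {ν ν' : Measure (UnitSphere k)} [IsFiniteMeasure ν]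
    [IsFiniteMeasure ν']
    (h : ∀ A : Finset (Space k), A.Nonempty →
      ∫ x : UnitSphere k, supportFun (A : Set (Space k)) (x : Space k) ∂ν =
        ∫ x : UnitSphere k, supportFun (A : Set (Space k)) (x : Space k) ∂ν') : ν = ν' := by
  apply ext_of_forall_integral_eq_of_IsFiniteMeasure
  intro f
  refine congrFun (Continuous.ext_on (dense_supportDifference (k := k))
    (continuous_integral_continuousMap ν) (continuous_integral_continuousMap ν') ?_)
    (f : C(UnitSphere k, ℝ))
  rintro g ⟨A, B, hA, hB, hg⟩
  simp only [hg]
  rw [integral_sub (integrable_supportFun ν hA) (integrable_supportFun ν hB),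
    integral_sub (integrable_supportFun ν' hA) (integrable_supportFun ν' hB), h A hA, h B hB]

/-- Moving the subtracted terms across compares `A + D` with `C + B`. This gives both
well-definedness and positivity of the induced functional. -/
theorem IsLinearSemidiversity.sub_le_sub {δ : Finset (Space k) → ℝ} (hδ : IsLinearSemidiversity δ)
    {A B C D : Finset (Space k)} (hA : A.Nonempty) (hB : B.Nonempty) (hC : C.Nonempty)
    (hD : D.Nonempty) (h : ∀ x : UnitSphere k,
      supportFun (A : Set (Space k)) (x : Space k) - supportFun (B : Set (Space k)) x ≤
        supportFun (C : Set (Space k)) (x : Space k) - supportFun (D : Set (Space k)) x) :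
    δ A - δ B ≤ δ C - δ D := by
  have := hδ.le_of_supportFun_le (A := A + D) (B := C + B) (hC.add hB) fun x => by
    rw [supportFun_add hA hD, supportFun_add hC hB]
    linarith [h x]
  rw [hδ.linear.map_add _ _ hA hD, hδ.linear.map_add _ _ hC hB] at this
  linarith

/-- A linear semidiversity induces a positive linear functional on differences of support
functions. -/
theorem IsLinearSemidiversity.exists_linearMap {δ : Finset (Space k) → ℝ}
    (hδ : IsLinearSemidiversity δ) :
    ∃ φ : supportDifference k →ₗ[ℝ] ℝ, ∀ (f : supportDifference k) (A B : Finset (Space k)),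
      A.Nonempty → B.Nonempty → (∀ x : UnitSphere k, (f : C(UnitSphere k, ℝ)) x =
        supportFun (A : Set (Space k)) (x : Space k) - supportFun (B : Set (Space k)) x) →
      φ f = δ A - δ B := by
  choose P N hP hN hPN using fun f : supportDifference k => f.2
  have key : ∀ (f : supportDifference k) (A B : Finset (Space k)),
      A.Nonempty → B.Nonempty → (∀ x : UnitSphere k, (f : C(UnitSphere k, ℝ)) x =
        supportFun (A : Set (Space k)) (x : Space k) - supportFun (B : Set (Space k)) x) →
      δ (P f) - δ (N f) = δ A - δ B := by
    intro f A B hA hB h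
    apply le_antisymm
    · exact hδ.sub_le_sub (hP f) (hN f) hA hB fun x => by rw [← h, ← hPN f]
    · exact hδ.sub_le_sub hA hB (hP f) (hN f) fun x => by rw [← h, ← hPN f]
  refine ⟨{ toFun := fun f => δ (P f) - δ (N f), map_add' := ?_, map_smul' := ?_ }, key⟩
  · intro f g
    rw [key (f + g) (P f + P g) (N f + N g) ((hP f).add (hP g)) ((hN f).add (hN g)),
      hδ.linear.map_add _ _ (hP f) (hP g), hδ.linear.map_add _ _ (hN f) (hN g)]
    · ring
    · intro x
      rw [supportFun_add (hP f) (hP g), supportFun_add (hN f) (hN g), Submodule.coe_add,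
        ContinuousMap.add_apply, hPN f, hPN g]
      ring
  · intro c f
    rw [RingHom.id_apply, smul_eq_mul]
    rcases le_total 0 c with hc | hc
    · rw [key (c • f) (c • P f) (c • N f) (hP f).smul_finset (hN f).smul_finset,
        hδ.linear.map_smul _ _ hc (hP f), hδ.linear.map_smul _ _ hc (hN f)]
      · ring
      · intro x
        rw [supportFun_smul (hP f) hc, supportFun_smul (hN f) hc, Submodule.coe_smul,
          ContinuousMap.smul_apply, hPN f, smul_eq_mul]
        ring
    · have hc' := neg_nonneg.2 hc
      rw [key (c • f) ((-c) • N f) ((-c) • P f) (hN f).smul_finset (hP f).smul_finset,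
        hδ.linear.map_smul _ _ hc' (hP f), hδ.linear.map_smul _ _ hc' (hN f)]
      · ring
      · intro x
        rw [supportFun_smul (hP f) hc', supportFun_smul (hN f) hc', Submodule.coe_smul,
          ContinuousMap.smul_apply, hPN f, smul_eq_mul]
        ring

theorem IsLinearSemidiversity.exists_positive_extension {δ : Finset (Space k) → ℝ}
    (hδ : IsLinearSemidiversity δ) :
    ∃ Λ : C(UnitSphere k, ℝ) →ₗ[ℝ] ℝ, (∀ f, 0 ≤ f → 0 ≤ Λ f) ∧
      ∀ (f : C(UnitSphere k, ℝ)) (A : Finset (Space k)), A.Nonempty →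
        (∀ x : UnitSphere k, f x = supportFun (A : Set (Space k)) (x : Space k)) → Λ f = δ A := by
  obtain ⟨φ, hφ⟩ := hδ.exists_linearMap
  obtain ⟨Λ, hΛ, hΛ0⟩ := riesz_extension (PointedCone.positive ℝ C(UnitSphere k, ℝ))
    ⟨supportDifference k, φ⟩ (by
      rintro ⟨f, A, B, hA, hB, hf⟩ hf0
      change 0 ≤ φ _
      rw [hφ _ A B hA hB hf, ← sub_self (δ {(0 : Space k)})]
      refine hδ.sub_le_sub (by simp) (by simp) hA hB fun x => ?_
      rw [sub_self, ← hf]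
      exact hf0 x) (by
      intro y
      -- Riesz extension needs some `f` in the subspace with `0 ≤ f + y`; being within `1` of `1 -
      -- y` is enough.
      obtain ⟨f, hf, hfy⟩ := (dense_supportDifference (k := k)).exists_dist_lt (1 - y) one_pos
      refine ⟨⟨f, hf⟩, fun x => ?_⟩
      have h1 := (ContinuousMap.dist_apply_le_dist x).trans_lt hfy
      rw [Real.dist_eq, abs_lt] at h1
      simp only [ContinuousMap.sub_apply, ContinuousMap.one_apply] at h1
      change 0 ≤ f x + y x
      linarith [h1.2])
  refine ⟨Λ, fun f hf => hΛ0 f hf, fun f A hA hf => ?_⟩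
  have hf0 : ∀ x : UnitSphere k, f x = supportFun (A : Set (Space k)) (x : Space k) -
      supportFun (({0} : Finset (Space k)) : Set (Space k)) x := fun x => by simp [hf]
  have h1 := hΛ ⟨f, A, {0}, hA, by simp, hf0⟩
  rw [h1]
  change φ _ = _
  rw [hφ _ A {0} hA (by simp) hf0, hδ.semidiversity.apply_singleton, sub_zero]

theorem integral_inner_coe (ν : Measure (UnitSphere k)) [IsFiniteMeasure ν] (a : Space k) :
    ∫ x : UnitSphere k, inner ℝ a (x : Space k) ∂ν = inner ℝ a (∫ x, (x : Space k) ∂ν) :=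
  integral_inner (integrable_of_continuous ν continuous_subtype_val) a

/-- Every linear semidiversity is represented by a finite measure on the sphere. -/
theorem IsLinearSemidiversity.exists_represents {δ : Finset (Space k) → ℝ}
    (hδ : IsLinearSemidiversity δ) :
    ∃ ν : Measure (UnitSphere k), IsFiniteMeasure ν ∧ Represents ν δ := by
  obtain ⟨Λ, hΛ, hΛδ⟩ := hδ.exists_positive_extension
  let Ψ : CompactlySupportedContinuousMap (UnitSphere k) ℝ →ₚ[ℝ] ℝ :=
    { toFun := fun f => Λ f.toContinuousMap
      map_add' := fun f g => Λ.map_add f.toContinuousMap g.toContinuousMap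
      map_smul' := fun c f => Λ.map_smul c f.toContinuousMap
      monotone' := fun f g hfg => by
        have := hΛ (g.toContinuousMap - f.toContinuousMap) fun x => sub_nonneg.2 (hfg x)
        rw [Λ.map_sub] at this
        exact sub_nonneg.1 this }
  have key : ∀ A : Finset (Space k), A.Nonempty → δ A =
      ∫ x : UnitSphere k, supportFun (A : Set (Space k)) (x : Space k)
        ∂(RealRMK.rieszMeasure Ψ) := by
    intro A hA
    let f : C(UnitSphere k, ℝ) := ⟨fun x => supportFun (A : Set (Space k)) (x : Space k),
      (continuous_supportFun hA).comp continuous_subtype_val⟩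
    rw [← hΛδ f A hA fun _ => rfl]
    exact (RealRMK.integral_rieszMeasure Ψ
      ⟨f, HasCompactSupport.of_compactSpace f⟩).symm
  refine ⟨RealRMK.rieszMeasure Ψ, inferInstance, ?_, key⟩
  refine ext_inner_left ℝ fun a => ?_
  rw [← integral_inner_coe, inner_zero_right, ← hδ.semidiversity.apply_singleton a,
    key {a} (by simp)]
  simp

/-! ### Semidiversities represented by centred measures -/

namespace Represents

variable {δ : Finset (Space k) → ℝ} {ν : Measure (UnitSphere k)}

theorem integral_inner_eq_zero [IsFiniteMeasure ν] (h : Represents ν δ) (a : Space k) :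
    ∫ x : UnitSphere k, inner ℝ a (x : Space k) ∂ν = 0 := by
  rw [integral_inner_coe, h.centroid_eq_zero, inner_zero_right]

/-- The triangle inequality holds pointwise once `⟪b, x⟫`, `b ∈ B`, is added to the left side, and
this term integrates to zero. A representation is silent on `∅`, whence `h0`. -/
theorem isLinearSemidiversity [IsFiniteMeasure ν] (h : Represents ν δ) (h0 : δ ∅ = 0) :
    IsLinearSemidiversity δ := by
  have hint : ∀ a : Space k, Integrable (fun x : UnitSphere k => inner ℝ a (x : Space k)) ν :=
    fun a => integrable_of_continuous ν (by fun_prop)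
  have hnonneg : ∀ A, 0 ≤ δ A := by
    intro A
    rcases A.eq_empty_or_nonempty with rfl | hA
    · exact h0.ge
    · obtain ⟨a, ha⟩ := hA
      rw [h.eq_integral A ⟨a, ha⟩, ← h.integral_inner_eq_zero a]
      exact integral_mono (hint a) (integrable_supportFun ν ⟨a, ha⟩)
        fun x => inner_le_supportFun ha _
  refine ⟨⟨hnonneg, ?_, ?_⟩, ⟨?_, ?_⟩⟩
  · intro A hA
    rcases A.eq_empty_or_nonempty with rfl | hA'
    · exact h0
    · obtain ⟨a, rfl⟩ := Finset.card_eq_one.1 (le_antisymm hA hA'.card_pos)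
      rw [h.eq_integral _ hA', ← h.integral_inner_eq_zero a]
      simp
  · suffices H : ∀ A B C : Finset (Space k), B.Nonempty → δ (A ∪ C) ≤ δ (A ∪ B) + δ (B ∪ C) by
      intro A B C hB
      convert! H A B C hB
    intro A B C hB
    rcases (A ∪ C).eq_empty_or_nonempty with hAC | hAC
    · rw [hAC, h0]
      exact add_nonneg (hnonneg _) (hnonneg _)
    · obtain ⟨b, hb⟩ := hB
      have hAB : (A ∪ B).Nonempty := ⟨b, by simp [hb]⟩
      have hBC : (B ∪ C).Nonempty := ⟨b, by simp [hb]⟩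
      rw [h.eq_integral _ hAC, h.eq_integral _ hAB, h.eq_integral _ hBC,
        ← integral_add (integrable_supportFun ν hAB) (integrable_supportFun ν hBC),
        ← add_zero (∫ x : UnitSphere k, supportFun _ _ ∂ν), ← h.integral_inner_eq_zero b,
        ← integral_add (integrable_supportFun ν hAC) (hint b)]
      refine integral_mono ((integrable_supportFun ν hAC).add (hint b))
        ((integrable_supportFun ν hAB).add (integrable_supportFun ν hBC)) fun x => ?_
      simp only
      obtain ⟨a, ha, hax⟩ := exists_supportFun_eq hAC (x : Space k)
      rw [hax]
      rcases Finset.mem_union.1 ha with ha | ha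
      · exact add_le_add (inner_le_supportFun (by simp [ha]) _)
          (inner_le_supportFun (by simp [hb]) _)
      · rw [add_comm]
        exact add_le_add (inner_le_supportFun (by simp [hb]) _)
          (inner_le_supportFun (by simp [ha]) _)
  · intro c A hc hA
    rw [h.eq_integral _ hA, h.eq_integral _ hA.smul_finset, ← integral_const_mul]
    simp only [supportFun_smul hA hc]
  · intro A B hA hB
    rw [h.eq_integral _ hA, h.eq_integral _ hB, h.eq_integral _ (hA.add hB),
      ← integral_add (integrable_supportFun ν hA) (integrable_supportFun ν hB)]
    simp only [supportFun_add hA hB]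

theorem unique [IsFiniteMeasure ν] {ν' : Measure (UnitSphere k)} [IsFiniteMeasure ν']
    (h : Represents ν δ) (h' : Represents ν' δ) : ν = ν' :=
  measure_ext_of_integral_supportFun fun A hA => by
    rw [← h.eq_integral A hA, ← h'.eq_integral A hA]

theorem smul (h : Represents ν δ) {c : ℝ} (hc : 0 ≤ c) :
    Represents (ENNReal.ofReal c • ν) (c • δ) :=
  ⟨by rw [integral_smul_measure, h.centroid_eq_zero, smul_zero], fun A hA => by
    rw [integral_smul_measure, ← h.eq_integral A hA, ENNReal.toReal_ofReal hc, Pi.smul_apply]⟩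

theorem add [IsFiniteMeasure ν] {ν' : Measure (UnitSphere k)} [IsFiniteMeasure ν']
    {δ' : Finset (Space k) → ℝ} (h : Represents ν δ) (h' : Represents ν' δ') :
    Represents (ν + ν') (δ + δ') :=
  ⟨by
    rw [integral_add_measure (integrable_of_continuous ν continuous_subtype_val)
      (integrable_of_continuous ν' continuous_subtype_val), h.centroid_eq_zero,
      h'.centroid_eq_zero, add_zero], fun A hA => by
    rw [integral_add_measure (integrable_supportFun ν hA) (integrable_supportFun ν' hA),
      ← h.eq_integral A hA, ← h'.eq_integral A hA, Pi.add_apply]⟩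

theorem measureReal_univ_pos [IsFiniteMeasure ν] (h : Represents ν δ) (h0 : δ ∅ = 0)
    (hδ : δ ≠ 0) : 0 < ν.real Set.univ := by
  refine lt_of_le_of_ne measureReal_nonneg fun hν => hδ (funext fun A => ?_)
  have hν0 : ν = 0 := by
    rw [← Measure.measure_univ_eq_zero]
    exact (measureReal_eq_zero_iff).1 hν.symm
  rcases A.eq_empty_or_nonempty with rfl | hA
  · exact h0
  · rw [h.eq_integral A hA, hν0, integral_zero_measure, Pi.zero_apply]

end Represents

/-! ### Extremal semidiversities have affinely independent support -/

/-- The measure with density `1 + g`. -/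
noncomputable def perturbedMeasure (ν : Measure (UnitSphere k)) (g : UnitSphere k → ℝ) :
    Measure (UnitSphere k) :=
  ν.withDensity fun x => ENNReal.ofReal (1 + g x)

theorem integrable_smul_of_bounded {ν : Measure (UnitSphere k)} {g : UnitSphere k → ℝ}
    (hg : Measurable g) {M : ℝ} (hgM : ∀ x, |g x| ≤ M) {E : Type*} [NormedAddCommGroup E]
    [NormedSpace ℝ E] {F : UnitSphere k → E} (hF : Integrable F ν) :
    Integrable (fun x => g x • F x) ν :=
  hF.bdd_smul M hg.aestronglyMeasurable (Filter.Eventually.of_forall hgM)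

theorem integral_perturbedMeasure {ν : Measure (UnitSphere k)} {g : UnitSphere k → ℝ}
    (hg : Measurable g) (hg1 : ∀ x, |g x| ≤ 1) {E : Type*} [NormedAddCommGroup E] [NormedSpace ℝ E] {F : UnitSphere k → E}
    (hF : Integrable F ν) :
    ∫ x, F x ∂(perturbedMeasure ν g) = ∫ x, F x ∂ν + ∫ x, g x • F x ∂ν := by
  rw [perturbedMeasure, integral_withDensity_eq_integral_toReal_smul (by fun_prop) (by simp),
    ← integral_add hF (integrable_smul_of_bounded hg hg1 hF)]
  congr 1
  ext1 x
  rw [ENNReal.toReal_ofReal (by linarith [(abs_le.1 (hg1 x)).1]), add_smul, one_smul]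

section Perturbation

variable {ν : Measure (UnitSphere k)} [IsFiniteMeasure ν] {g : UnitSphere k → ℝ}

theorem integrable_of_bounded (hg : Measurable g) {M : ℝ} (hgM : ∀ x, |g x| ≤ M) :
    Integrable g ν :=
  Integrable.of_bound hg.aestronglyMeasurable M (Filter.Eventually.of_forall hgM)

theorem isFiniteMeasure_perturbedMeasure (hg : Measurable g) (hg1 : ∀ x, |g x| ≤ 1) :
    IsFiniteMeasure (perturbedMeasure ν g) :=
  isFiniteMeasure_withDensity_ofReal
    ((integrable_const (1 : ℝ)).add (integrable_of_bounded hg hg1)).2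

theorem exists_represents_perturbedMeasure {δ : Finset (Space k) → ℝ} (h : Represents ν δ)
    (hg : Measurable g) (hg1 : ∀ x, |g x| ≤ 1) (hgx : ∫ x, g x • (x : Space k) ∂ν = 0) :
    ∃ δ' : Finset (Space k) → ℝ, IsLinearSemidiversity δ' ∧
      Represents (perturbedMeasure ν g) δ' ∧ δ' ∅ = 0 ∧ ∀ A : Finset (Space k), A.Nonempty →
        δ' A = δ A + ∫ x, g x * supportFun (A : Set (Space k)) (x : Space k) ∂ν := by
  have := isFiniteMeasure_perturbedMeasure (ν := ν) hg hg1
  let δ' : Finset (Space k) → ℝ := fun A => if A.Nonempty then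
    ∫ x : UnitSphere k, supportFun (A : Set (Space k)) (x : Space k) ∂(perturbedMeasure ν g) else 0
  have h0 : δ' ∅ = 0 := by simp [δ']
  have hr : Represents (perturbedMeasure ν g) δ' := by
    refine ⟨?_, fun A hA => by simp [δ', hA]⟩
    rw [integral_perturbedMeasure hg hg1 (integrable_of_continuous ν continuous_subtype_val),
      h.centroid_eq_zero, hgx, add_zero]
  refine ⟨δ', hr.isLinearSemidiversity h0, hr, h0, fun A hA => ?_⟩
  rw [hr.eq_integral A hA, integral_perturbedMeasure hg hg1 (integrable_supportFun ν hA),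
    h.eq_integral A hA]
  rfl

/-- The semidiversities of `(1 + g)ν` and `(1 - g)ν` have midpoint `δ`. Extremality and uniqueness
give `(1 + g)ν = cν`; total mass forces `c = 1`, and testing against `g` gives `∫ g² = 0`. -/
theorem IsExtremalLinear.ae_eq_zero_of_abs_le_one {δ : Finset (Space k) → ℝ}
    (hδ : IsExtremalLinear δ) (h : Represents ν δ) (hg : Measurable g) (hg1 : ∀ x, |g x| ≤ 1)
    (hg0 : ∫ x, g x ∂ν = 0) (hgx : ∫ x, g x • (x : Space k) ∂ν = 0) : g =ᵐ[ν] 0 := by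
  have hδ0 := hδ.isLinearSemidiversity.semidiversity.apply_empty
  obtain ⟨δ₁, hδ₁, hr₁, h₁0, h₁⟩ := exists_represents_perturbedMeasure h hg hg1 hgx
  obtain ⟨δ₂, hδ₂, -, h₂0, h₂⟩ := exists_represents_perturbedMeasure (g := fun x => -g x) h
    hg.neg (by simpa using hg1) (by simp [integral_neg, hgx])
  have hsum : δ = (1 / 2 : ℝ) • δ₁ + (1 - 1 / 2 : ℝ) • δ₂ := by
    ext A
    rw [Pi.add_apply, Pi.smul_apply, Pi.smul_apply, smul_eq_mul, smul_eq_mul]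
    rcases A.eq_empty_or_nonempty with rfl | hA
    · rw [hδ0, h₁0, h₂0]
      ring
    · rw [h₁ A hA, h₂ A hA]
      simp only [neg_mul, integral_neg]
      ring
  obtain ⟨⟨c, hc, hcδ⟩, -⟩ := hδ.extremal δ₁ δ₂ (1 / 2) hδ₁ hδ₂ (by norm_num) (by norm_num) hsum
  have := isFiniteMeasure_perturbedMeasure (ν := ν) hg hg1
  have hfin : IsFiniteMeasure (ENNReal.ofReal c • ν) := Measure.smul_finite ν ENNReal.ofReal_ne_top
  have hν : perturbedMeasure ν g = ENNReal.ofReal c • ν := hr₁.unique (hcδ ▸ h.smul hc)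
  have key : ∀ F : UnitSphere k → ℝ, Integrable F ν →
      ∫ x, F x ∂ν + ∫ x, g x * F x ∂ν = c * ∫ x, F x ∂ν := by
    intro F hF
    have h1 := integral_perturbedMeasure hg hg1 hF
    rw [hν, integral_smul_measure, ENNReal.toReal_ofReal hc, smul_eq_mul] at h1
    exact h1.symm
  have hpos := h.measureReal_univ_pos hδ0 hδ.ne_zero
  have hc1 : c = 1 := by
    have h1 := key (fun _ => 1) (integrable_const _)
    simp only [mul_one, hg0, add_zero, integral_const, smul_eq_mul] at h1
    exact (mul_right_cancel₀ hpos.ne' (by rw [one_mul, ← h1]) : c = 1)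
  have hgg := key g (integrable_of_bounded hg hg1)
  rw [hc1, one_mul, add_eq_left, integral_eq_zero_iff_of_nonneg (fun x => mul_self_nonneg _)
    (integrable_smul_of_bounded hg hg1 (integrable_of_bounded hg hg1))] at hgg
  filter_upwards [hgg] with x hx
  exact mul_self_eq_zero.1 hx

theorem IsExtremalLinear.ae_eq_zero {δ : Finset (Space k) → ℝ}
    (hδ : IsExtremalLinear δ) (h : Represents ν δ) (hg : Measurable g) {M : ℝ}
    (hgM : ∀ x, |g x| ≤ M) (hg0 : ∫ x, g x ∂ν = 0) (hgx : ∫ x, g x • (x : Space k) ∂ν = 0) :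
    g =ᵐ[ν] 0 := by
  have hM : 0 < |M| + 1 := by positivity
  have h1 := hδ.ae_eq_zero_of_abs_le_one (g := fun x => (|M| + 1)⁻¹ * g x) h (hg.const_mul _)
    (fun x => by
      rw [abs_mul, abs_inv, abs_of_pos hM, inv_mul_le_one₀ hM]
      linarith [hgM x, le_abs_self M])
    (by rw [integral_const_mul, hg0, mul_zero])
    (by simp only [mul_smul, integral_smul, hgx, smul_zero])
  filter_upwards [h1] with x hx
  simpa [hM.ne'] using hx

/-- The step function with value `c i` on `U i` and zero elsewhere is an admissible perturbation,
hence null. -/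
theorem IsExtremalLinear.eq_zero_of_sum_eq_zero {δ : Finset (Space k) → ℝ}
    (hδ : IsExtremalLinear δ) (h : Represents ν δ) {ι : Type*} [Fintype ι]
    {U : ι → Set (UnitSphere k)} (hU : ∀ i, MeasurableSet (U i))
    (hdisj : Pairwise (Function.onFun Disjoint U)) (hpos : ∀ i, 0 < ν (U i)) {c : ι → ℝ}
    (hc : ∑ i, c i * ν.real (U i) = 0)
    (hcx : ∑ i, c i • ∫ x in U i, (x : Space k) ∂ν = 0) (i : ι) : c i = 0 := by
  have hcoe : Integrable (fun x : UnitSphere k => (x : Space k)) ν :=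
    integrable_of_continuous ν continuous_subtype_val
  let g : UnitSphere k → ℝ := fun x => ∑ i, (U i).indicator (fun _ => c i) x
  have hg : Measurable g :=
    Finset.measurable_sum _ fun i _ => measurable_const.indicator (hU i)
  have hgM : ∀ x, |g x| ≤ ∑ i, |c i| := fun x =>
    (Finset.abs_sum_le_sum_abs _ _).trans <| Finset.sum_le_sum fun i _ => by
      by_cases hx : x ∈ U i <;> simp [hx]
  have hg0 : ∫ x, g x ∂ν = 0 := by
    rw [integral_finsetSum _ fun i _ => (integrable_const _).indicator (hU i), ← hc]
    refine Finset.sum_congr rfl fun i _ => ?_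
    rw [integral_indicator_const _ (hU i), smul_eq_mul, mul_comm]
  have hgx : ∫ x, g x • (x : Space k) ∂ν = 0 := by
    simp only [g, Finset.sum_smul, ← Set.indicator_smul_apply_left]
    rw [integral_finsetSum (f := fun i => (U i).indicator fun x => c i • (x : Space k)) _
      fun i _ => (hcoe.smul (c i)).indicator (hU i)]
    refine (Finset.sum_congr rfl fun i _ => ?_).trans hcx
    rw [integral_indicator (hU i), integral_smul]
  have hae := hδ.ae_eq_zero h hg hgM hg0 hgx
  obtain ⟨x, hx, hx0⟩ : ∃ x ∈ U i, g x = 0 := by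
    by_contra! hne
    exact (hpos i).ne' (measure_mono_null (fun x hx => hne x hx) (ae_iff.1 hae))
  have hgi : g x = c i := by
    refine (Finset.sum_eq_single i (fun j _ hj => ?_) (by simp)).trans
      (Set.indicator_of_mem hx _)
    exact Set.indicator_of_notMem (fun hxj => (hdisj hj).le_bot ⟨hxj, hx⟩) _
  rw [← hgi, hx0]

end Perturbation

theorem IsExtremalLinear.finite_support {δ : Finset (Space k) → ℝ} {ν : Measure (UnitSphere k)}
    [IsFiniteMeasure ν] (hδ : IsExtremalLinear δ) (h : Represents ν δ) : ν.support.Finite := by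
  by_contra hinf
  -- First moment and mass together lie in a space of dimension `k + 1`, so `k + 2` disjoint
  -- neighbourhoods yield a dependence.
  obtain ⟨T, hT, hcard⟩ := Set.Infinite.exists_subset_card_eq hinf (k + 2)
  obtain ⟨V, hV, hdisj⟩ := T.finite_toSet.t2_separation
  let p : T → Space k × ℝ := fun i => (∫ x in V i, (x : Space k) ∂ν, ν.real (V i))
  have hdep : ¬ LinearIndependent ℝ p := by
    intro hli
    have h1 := hli.fintype_card_le_finrank
    rw [Fintype.card_coe, hcard, Module.finrank_prod, finrank_euclideanSpace_fin,
      Module.finrank_self] at h1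
    omega
  obtain ⟨c, hc, i, hi⟩ := Fintype.not_linearIndependent_iff.1 hdep
  refine hi (hδ.eq_zero_of_sum_eq_zero h (U := fun i : T => V i)
    (fun i => (hV i).2.measurableSet)
    (fun i j hij => hdisj i.2 j.2 (Subtype.coe_injective.ne hij))
    (fun i => (Measure.mem_support_iff_forall _).1 (hT i.2) _ ((hV i).2.mem_nhds (hV i).1))
    ?_ ?_ i)
  · simpa [p, Prod.snd_sum] using congrArg Prod.snd hc
  · simpa [p, Prod.fst_sum] using congrArg Prod.fst hc

theorem measure_singleton_pos_of_finite_support {ν : Measure (UnitSphere k)}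
    (hν : ν.support.Finite) {x : UnitSphere k} (hx : x ∈ ν.support) : 0 < ν {x} := by
  -- This neighbourhood of `x` meets the support only in `x`, so all its mass sits there.
  have hU : IsOpen (ν.support \ {x})ᶜ := (hν.subset Set.sdiff_subset).isClosed.isOpen_compl
  have h1 := (Measure.mem_support_iff_forall _).1 hx _ (hU.mem_nhds (by simp))
  refine h1.trans_le ((measure_mono (t := {x} ∪ ν.supportᶜ) fun y hy => ?_).trans
    ((measure_union_le _ _).trans (by rw [Measure.measure_compl_support, add_zero])))
  by_cases hyx : y = x
  · exact Or.inl hyx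
  · exact Or.inr fun hys => hy ⟨hys, hyx⟩

theorem isAffinelyIndependentSet_supportSet_iff {ν : Measure (UnitSphere k)} :
    IsAffinelyIndependentSet (supportSet ν) ↔
      AffineIndependent ℝ fun x : ν.support => ((x : UnitSphere k) : Space k) := by
  let e : ν.support ≃ supportSet ν :=
    Equiv.Set.image _ _ Subtype.val_injective
  exact (affineIndependent_equiv e).symm

theorem IsExtremalLinear.isAffinelyIndependentSet_supportSet {δ : Finset (Space k) → ℝ}
    {ν : Measure (UnitSphere k)} [IsFiniteMeasure ν] (hδ : IsExtremalLinear δ)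
    (h : Represents ν δ) : IsAffinelyIndependentSet (supportSet ν) := by
  have hfin := hδ.finite_support h
  have hpos : ∀ x ∈ ν.support, 0 < ν {x} := fun x => measure_singleton_pos_of_finite_support hfin
  have hpos' : ∀ x ∈ ν.support, ν.real {x} ≠ 0 := fun x hx =>
    (ENNReal.toReal_pos (hpos x hx).ne' (measure_ne_top _ _)).ne'
  rw [isAffinelyIndependentSet_supportSet_iff, affineIndependent_iff]
  intro s w hw hwx e he
  have h1 := hδ.eq_zero_of_sum_eq_zero h (ι := s) (U := fun i => {(i : ν.support).1})
    (fun i => MeasurableSet.singleton _)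
    (fun i j hij => Set.disjoint_singleton.2 fun hij' =>
      hij (Subtype.ext (Subtype.ext hij')))
    -- Dividing by the atoms turns an affine relation into a perturbation with zero mass and zero
    -- moment.
    (fun i => hpos _ i.1.2) (c := fun i => w i / ν.real {(i : ν.support).1}) ?_ ?_ ⟨e, he⟩
  · exact (div_eq_zero_iff.1 h1).resolve_right (hpos' _ e.2)
  · refine (Finset.sum_congr rfl fun i _ => ?_).trans ((s.sum_coe_sort w).trans hw)
    exact div_mul_cancel₀ _ (hpos' _ i.1.2)
  · refine (Finset.sum_congr rfl fun i _ => ?_).trans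
      ((s.sum_coe_sort fun e => w e • ((e : UnitSphere k) : Space k)).trans hwx)
    rw [integral_singleton, smul_smul, div_mul_cancel₀ _ (hpos' _ i.1.2)]

/-! ### Measures with affinely independent support give extremal semidiversities -/

theorem integral_eq_sum_of_finite_support {ν μ : Measure (UnitSphere k)} [IsFiniteMeasure μ]
    (hν : ν.support.Finite) (hμ : μ ν.supportᶜ = 0) {E : Type*} [NormedAddCommGroup E]
    [NormedSpace ℝ E] [CompleteSpace E] {F : UnitSphere k → E} (hF : Continuous F) :
    ∫ x, F x ∂μ = ∑ x ∈ hν.toFinset, μ.real {x} • F x := by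
  rw [← setIntegral_finset _ (integrable_of_continuous μ hF).integrableOn, hν.coe_toFinset,
    setIntegral_eq_integral_of_ae_compl_eq_zero]
  have h1 : ∀ᵐ x ∂μ, x ∈ ν.support := by
    rw [ae_iff]
    exact hμ
  filter_upwards [h1] with x hx hx'
  exact absurd hx hx'

theorem isScaleCopy_of_affinelyIndependent_support {δ δ' : Finset (Space k) → ℝ}
    {ν μ : Measure (UnitSphere k)} [IsFiniteMeasure ν] [IsFiniteMeasure μ] (h : Represents ν δ)
    (h' : Represents μ δ') (h0 : δ ∅ = 0) (h0' : δ' ∅ = 0) (hδ : δ ≠ 0)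
    (hfin : ν.support.Finite) (hind : IsAffinelyIndependentSet (supportSet ν))
    (hμ : μ ν.supportᶜ = 0) : IsScaleCopy δ' δ := by
  have hpos := h.measureReal_univ_pos h0 hδ
  -- With this ratio `μ - cν` has total mass zero; as both measures are centred, its atoms form an
  -- affine relation on the support.
  set c := μ.real Set.univ / ν.real Set.univ with hc
  have hsum {E : Type} [NormedAddCommGroup E] [NormedSpace ℝ E] [CompleteSpace E]
      (F : UnitSphere k → E) (hF : Continuous F) : ∫ x, F x ∂μ - c • ∫ x, F x ∂ν =
        ∑ x ∈ hfin.toFinset, (μ.real {x} - c * ν.real {x}) • F x := by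
    rw [integral_eq_sum_of_finite_support hfin hμ hF,
      integral_eq_sum_of_finite_support hfin Measure.measure_compl_support hF, Finset.smul_sum,
      ← Finset.sum_sub_distrib]
    exact Finset.sum_congr rfl fun x _ => by rw [sub_smul, mul_smul]
  rw [isAffinelyIndependentSet_supportSet_iff, affineIndependent_iff] at hind
  have hw : ∀ x ∈ hfin.toFinset, μ.real {x} - c * ν.real {x} = 0 := by
    intro x hx
    have hmem : ∀ y ∈ hfin.toFinset, y ∈ ν.support := fun y hy => hfin.mem_toFinset.1 hy
    refine hind (hfin.toFinset.subtype (· ∈ ν.support))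
      (fun y => μ.real {(y : UnitSphere k)} - c * ν.real {(y : UnitSphere k)}) ?_ ?_
      ⟨x, hmem x hx⟩ (by simpa using hx)
    · rw [Finset.sum_subtype_of_mem (fun y => μ.real {y} - c * ν.real {y}) hmem]
      have h1 := hsum (fun _ => (1 : ℝ)) continuous_const
      simp only [integral_const, smul_eq_mul, mul_one] at h1
      rw [← h1, hc, div_mul_cancel₀ _ hpos.ne', sub_self]
    · rw [Finset.sum_subtype_of_mem (fun y => (μ.real {y} - c * ν.real {y}) • (y : Space k)) hmem]
      rw [← hsum _ continuous_subtype_val, h.centroid_eq_zero, h'.centroid_eq_zero, smul_zero,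
        sub_zero]
  refine ⟨c, by positivity, funext fun A => ?_⟩
  rw [Pi.smul_apply]
  rcases A.eq_empty_or_nonempty with rfl | hA
  · rw [h0, h0', smul_zero]
  · rw [h.eq_integral A hA, h'.eq_integral A hA, ← sub_eq_zero]
    refine (hsum _ ((continuous_supportFun hA).comp continuous_subtype_val)).trans ?_
    exact Finset.sum_eq_zero fun x hx => by rw [hw x hx, zero_smul]

theorem Represents.isExtremalLinear {δ : Finset (Space k) → ℝ}
    {ν : Measure (UnitSphere k)} [IsFiniteMeasure ν] (h : Represents ν δ) (h0 : δ ∅ = 0)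
    (hδ : δ ≠ 0) (hfin : ν.support.Finite) (hind : IsAffinelyIndependentSet (supportSet ν)) :
    IsExtremalLinear δ := by
  have key : ∀ (δ₁ δ₂ : Finset (Space k) → ℝ) (t : ℝ), IsLinearSemidiversity δ₁ →
      IsLinearSemidiversity δ₂ → 0 < t → t < 1 → δ = t • δ₁ + (1 - t) • δ₂ →
      IsScaleCopy δ₁ δ := by
    intro δ₁ δ₂ t h₁ h₂ ht ht' hsum
    obtain ⟨ν₁, _, hν₁⟩ := h₁.exists_represents
    obtain ⟨ν₂, _, hν₂⟩ := h₂.exists_represents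
    have hf₁ : IsFiniteMeasure (ENNReal.ofReal t • ν₁) :=
      Measure.smul_finite ν₁ ENNReal.ofReal_ne_top
    have hf₂ : IsFiniteMeasure (ENNReal.ofReal (1 - t) • ν₂) :=
      Measure.smul_finite ν₂ ENNReal.ofReal_ne_top
    have hν := h.unique (hsum ▸ (hν₁.smul ht.le).add (hν₂.smul (sub_nonneg.2 ht'.le)))
    refine isScaleCopy_of_affinelyIndependent_support h hν₁ h0 h₁.semidiversity.apply_empty hδ
      hfin hind ?_
    have h1 : ν ν.supportᶜ = 0 := Measure.measure_compl_support
    rw [congrArg (fun m : Measure (UnitSphere k) => m ν.supportᶜ) hν] at h1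
    -- A summand of `ν` with positive coefficient is null wherever `ν` is.
    simpa [ht.not_ge] using (add_eq_zero.1 h1).1
  refine ⟨h.isLinearSemidiversity h0, hδ, fun δ₁ δ₂ t h₁ h₂ ht ht' hsum =>
    ⟨key δ₁ δ₂ t h₁ h₂ ht ht' hsum, key δ₂ δ₁ (1 - t) h₂ h₁ (by linarith) (by linarith) ?_⟩⟩
  rw [hsum, sub_sub_cancel, add_comm]

/-! ### Simplices and their facet normals -/

/-- `v` are the vertices and `u` the scaled outer facet normals of a simplex, which is cut out
inside its affine span by the inequalities `⟪u i, y⟫ ≤ b i`. -/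
structure IsSimplexPair {ι : Type*} [Fintype ι] (u v : ι → Space k) (b : ι → ℝ) : Prop where
  sum_normal : ∑ i, u i = 0
  sum_offset : ∑ i, b i = 1
  inner_eq : ∀ i j, inner ℝ (u i) (v j) = b i - if i = j then 1 else 0
  mem_orthogonal_iff : ∀ y, y ∈ (affineSpan ℝ (Set.range v)).directionᗮ ↔
    ∀ i, inner ℝ (u i) y = 0

namespace IsSimplexPair

variable {ι : Type*} [Fintype ι] {u v : ι → Space k} {b : ι → ℝ}

theorem inner_sum (h : IsSimplexPair u v b) (a : ι → ℝ) (i : ι) :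
    inner ℝ (u i) (∑ j, a j • v j) = b i * ∑ j, a j - a i := by
  simp only [_root_.inner_sum, real_inner_smul_right, h.inner_eq, mul_sub, Finset.sum_sub_distrib,
    mul_ite, mul_one, mul_zero, Finset.sum_ite_eq, Finset.mem_univ, if_true, ← Finset.sum_mul]
  ring

/-- The slacks `b i - ⟪u i, y⟫` sum to one and are the barycentric coordinates of the projection of
`y` to the affine hull. -/
theorem mem_simplexKernel_iff (h : IsSimplexPair u v b) (y : Space k) :
    y ∈ simplexKernel (Set.range v) ↔ ∀ i, inner ℝ (u i) y ≤ b i := by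
  constructor
  · rintro ⟨p, hp, q, hq, rfl⟩ i
    have hsub : convexHull ℝ (Set.range v) ⊆ {p | inner ℝ (u i) p ≤ b i} := by
      refine convexHull_min ?_ ?_
      · rintro _ ⟨j, rfl⟩
        rw [Set.mem_ofPred_eq, h.inner_eq]
        split_ifs <;> linarith
      · exact convex_halfSpace_le (IsLinearMap.mk (inner_add_right _)
          fun c x => real_inner_smul_right _ _ _) _
    simp only
    rw [inner_add_right, (h.mem_orthogonal_iff q).1 hq i, add_zero]
    exact hsub hp
  · intro hy
    have hsum : ∑ i, (b i - inner ℝ (u i) y) = 1 := by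
      rw [Finset.sum_sub_distrib, h.sum_offset, ← sum_inner, h.sum_normal, inner_zero_left,
        sub_zero]
    refine Set.mem_add.2 ⟨∑ i, (b i - inner ℝ (u i) y) • v i, ?_,
      y - ∑ i, (b i - inner ℝ (u i) y) • v i, ?_, by abel⟩
    · exact (convex_convexHull ℝ _).sum_mem (fun i _ => sub_nonneg.2 (hy i)) hsum
        fun i _ => subset_convexHull ℝ _ ⟨i, rfl⟩
    · refine (h.mem_orthogonal_iff _).2 fun i => ?_
      rw [inner_sub_right, h.inner_sum, hsum]
      ring

theorem sum_supportFun_nonneg (h : IsSimplexPair u v b) {A : Finset (Space k)}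
    (hA : A.Nonempty) : 0 ≤ ∑ i, supportFun (A : Set (Space k)) (u i) := by
  obtain ⟨a, ha⟩ := hA
  calc (0 : ℝ) = ∑ i, inner ℝ a (u i) := by rw [← _root_.inner_sum, h.sum_normal, inner_zero_right]
    _ ≤ _ := Finset.sum_le_sum fun i _ => inner_le_supportFun ha _

theorem genCircumradius_eq_sum (h : IsSimplexPair u v b) {A : Finset (Space k)}
    (hA : A.Nonempty) :
    genCircumradius (simplexKernel (Set.range v)) (A : Set (Space k)) =
      ∑ i, supportFun (A : Set (Space k)) (u i) := by
  set s := ∑ i, supportFun (A : Set (Space k)) (u i) with hs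
  have hs0 : 0 ≤ s := h.sum_supportFun_nonneg hA
  -- Only `r > 0` is considered: `0 • K` is a single point and loses the unbounded directions, so
  -- the infimum need not be attained.
  have hmem : ∀ r, 0 < r → s ≤ r →
      ∃ x : Space k, (A : Set (Space k)) ⊆ r • simplexKernel (Set.range v) + {x} := by
    intro r hr hsr
    have hcard : 0 < (Fintype.card ι : ℝ) := by
      have : Nonempty ι := by
        by_contra hne
        rw [not_nonempty_iff] at hne
        simpa using h.sum_offset
      exact_mod_cast Fintype.card_pos
    -- Sharing the surplus `r - s` equally makes `∑ i, d i = 0`, so some translation `x` has `⟪u i,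
    -- x⟫ = d i` for all `i`.
    set d : ι → ℝ := fun i =>
      supportFun (A : Set (Space k)) (u i) - r * b i + (r - s) / Fintype.card ι with hd
    have hd0 : ∑ i, d i = 0 := by
      simp only [hd, Finset.sum_add_distrib, Finset.sum_sub_distrib, ← Finset.mul_sum,
        h.sum_offset, Finset.sum_const, Finset.card_univ, nsmul_eq_mul, ← hs]
      field_simp
      ring
    refine ⟨∑ j, (-d j) • v j, fun a ha => ?_⟩
    refine Set.mem_add.2 ⟨a - ∑ j, (-d j) • v j, ?_, _, rfl, by abel⟩
    rw [Set.mem_smul_set_iff_inv_smul_mem₀ hr.ne', h.mem_simplexKernel_iff]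
    intro i
    rw [real_inner_smul_right, inner_sub_right, h.inner_sum, Finset.sum_neg_distrib, hd0,
      inv_mul_le_iff₀ hr, real_inner_comm]
    have h1 := inner_le_supportFun (Finset.mem_coe.1 ha) (u i)
    have h2 : 0 ≤ (r - s) / Fintype.card ι := div_nonneg (sub_nonneg.2 hsr) hcard.le
    simp only [hd]
    linarith
  refine le_antisymm (le_of_forall_pos_le_add fun ε hε => ?_) ?_
  · exact csInf_le ⟨0, fun r hr => hr.1⟩
      ⟨by positivity, hmem (s + ε) (by positivity) (by linarith)⟩
  · refine le_csInf ⟨s + 1, by positivity, hmem (s + 1) (by positivity) (by linarith)⟩ ?_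
    rintro r ⟨hr, x, hx⟩
    have key : ∀ i, supportFun (A : Set (Space k)) (u i) ≤ r * b i + inner ℝ (u i) x := by
      intro i
      rw [supportFun_le_iff hA]
      intro a ha
      obtain ⟨_, ⟨y, hy, rfl⟩, _, rfl, rfl⟩ := hx ha
      simp only
      rw [real_inner_comm, inner_add_right, real_inner_smul_right]
      have := (h.mem_simplexKernel_iff y).1 hy i
      gcongr
    calc s ≤ ∑ i, (r * b i + inner ℝ (u i) x) := Finset.sum_le_sum fun i _ => key i
      _ = r := by
        rw [Finset.sum_add_distrib, ← Finset.mul_sum, h.sum_offset, ← sum_inner, h.sum_normal,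
          inner_zero_left, mul_one, add_zero]

theorem affineIndependent_vertices (h : IsSimplexPair u v b) : AffineIndependent ℝ v := by
  rw [affineIndependent_iff]
  intro s w hw hwv i hi
  have h1 := h.inner_sum (fun j => if j ∈ s then w j else 0) i
  simp only [ite_smul, zero_smul, Finset.sum_ite_mem, Finset.univ_inter, hw, hwv, hi, if_true,
    inner_zero_right] at h1
  linarith

theorem eq_of_normal_eq_zero (h : IsSimplexPair u v b) {i : ι} (hi : u i = 0) (j : ι) :
    j = i := by
  by_contra hne
  have h1 := h.inner_eq i i
  have h2 := h.inner_eq i j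
  rw [hi, inner_zero_left, if_pos rfl] at h1
  rw [hi, inner_zero_left, if_neg (Ne.symm hne)] at h2
  linarith

/-- Pairing a relation with each vertex shows that its weights are proportional to the norms `‖u i‖
> 0`; weights of sum zero must then vanish. -/
theorem affineIndependent_unit_normals (h : IsSimplexPair u v b) (hu : ∀ i, u i ≠ 0) :
    AffineIndependent ℝ fun i => ‖u i‖⁻¹ • u i := by
  rw [affineIndependent_iff]
  intro s w hw hwu
  have hn : ∀ i, 0 < ‖u i‖ := fun i => norm_pos_iff.2 (hu i)
  have key : ∀ j ∈ s, w j * ‖u j‖⁻¹ = ∑ i ∈ s, w i * ‖u i‖⁻¹ * b i := by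
    intro j hj
    have h1 : inner ℝ (∑ i ∈ s, w i • ‖u i‖⁻¹ • u i) (v j) = 0 := by
      rw [hwu, inner_zero_left]
    simp only [sum_inner, smul_smul, real_inner_smul_left, h.inner_eq, mul_sub,
      Finset.sum_sub_distrib, mul_ite, mul_one, mul_zero, Finset.sum_ite_eq', hj, if_true] at h1
    linarith
  set a := ∑ i ∈ s, w i * ‖u i‖⁻¹ * b i
  have hwa : ∀ j ∈ s, w j = a * ‖u j‖ := fun j hj => by
    rw [← key j hj, mul_assoc, inv_mul_cancel₀ (hn j).ne', mul_one]
  intro i hi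
  have ha : a = 0 := by
    rw [Finset.sum_congr rfl hwa, ← Finset.mul_sum] at hw
    exact (mul_eq_zero.1 hw).resolve_right (Finset.sum_pos (fun j _ => hn j) ⟨i, hi⟩).ne'
  rw [hwa i hi, ha, zero_mul]

theorem isMinkowskiSemidiversity (h : IsSimplexPair u v b) (hb : ∀ i, 0 < b i)
    {δ : Finset (Space k) → ℝ} (h0 : δ ∅ = 0) (hδ : ∀ A : Finset (Space k), A.Nonempty →
      δ A = ∑ i, supportFun (A : Set (Space k)) (u i)) :
    IsMinkowskiSemidiversity (simplexKernel (Set.range v)) δ := by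
  have hK : simplexKernel (Set.range v) = ⋂ i, {y | inner ℝ (u i) y ≤ b i} := by
    ext y
    rw [h.mem_simplexKernel_iff, Set.mem_iInter]
    rfl
  refine ⟨?_, ?_, ⟨0, ?_⟩, fun A => ?_⟩
  · rw [hK]
    exact isClosed_iInter fun i => isClosed_le (by fun_prop) continuous_const
  · rw [hK]
    exact convex_iInter fun i => convex_halfSpace_le (IsLinearMap.mk (inner_add_right _)
      fun c x => real_inner_smul_right _ _ _) _
  · refine mem_interior.2 ⟨⋂ i, {y | inner ℝ (u i) y < b i}, ?_, ?_, ?_⟩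
    · rw [hK]
      exact Set.iInter_mono fun i y (hy : inner ℝ (u i) y < b i) => hy.le
    · exact isOpen_iInter_of_finite fun i => isOpen_lt (by fun_prop) continuous_const
    · simpa using hb
  · rcases A.eq_empty_or_nonempty with rfl | hA
    · rw [h0]
      refine le_antisymm (Real.sInf_nonneg fun r hr => hr.1) (csInf_le ⟨0, fun r hr => hr.1⟩ ?_)
      exact ⟨le_rfl, 0, by simp⟩
    · rw [hδ A hA, h.genCircumradius_eq_sum hA]

end IsSimplexPair

/-- Lifting to the linearly independent vectors `(v j, 1)` lets a linear functional take prescribed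
values. -/
theorem exists_inner_add_const_eq {ι : Type*} {v : ι → Space k} (hv : AffineIndependent ℝ v)
    (d : ι → ℝ) : ∃ (g : Space k) (c : ℝ), ∀ j, inner ℝ g (v j) + c = d j := by
  have hli : LinearIndependent ℝ fun j => (v j, (1 : ℝ)) := by
    rw [linearIndependent_iff']
    intro s w hw
    rw [affineIndependent_iff] at hv
    refine hv s w ?_ ?_
    · simpa [Prod.snd_sum] using congrArg Prod.snd hw
    · simpa [Prod.fst_sum] using congrArg Prod.fst hw
  obtain ⟨f, hf⟩ := LinearMap.exists_extend ((Module.Basis.span hli).constr ℝ d)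
  have hfd : ∀ j, f (v j, 1) = d j := by
    intro j
    have h1 := LinearMap.congr_fun hf (Module.Basis.span hli j)
    rw [Module.Basis.constr_basis, LinearMap.comp_apply, Submodule.subtype_apply,
      Module.Basis.span_apply] at h1
    exact h1
  refine ⟨(InnerProductSpace.toDual ℝ (Space k)).symm
    (LinearMap.toContinuousLinearMap (f ∘ₗ LinearMap.inl ℝ (Space k) ℝ)), f (0, 1), fun j => ?_⟩
  rw [InnerProductSpace.toDual_symm_apply, ← hfd]
  simp [← map_add]

theorem sub_mem_direction_range {ι : Type*} (v : ι → Space k) (i j : ι) :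
    v i - v j ∈ (affineSpan ℝ (Set.range v)).direction :=
  AffineSubspace.vsub_mem_direction (mem_affineSpan ℝ ⟨i, rfl⟩) (mem_affineSpan ℝ ⟨j, rfl⟩)

theorem mem_orthogonal_direction_range_iff {ι : Type*} (v : ι → Space k) (y : Space k) :
    y ∈ (affineSpan ℝ (Set.range v)).directionᗮ ↔ ∀ i j, inner ℝ (v i - v j) y = 0 := by
  constructor
  · intro hy i j
    exact (Submodule.mem_orthogonal _ _).1 hy _ (sub_mem_direction_range v i j)
  · intro hy
    rw [direction_affineSpan, vectorSpan_def, Submodule.mem_orthogonal]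
    intro z hz
    induction hz using Submodule.span_induction with
    | mem z hz =>
      obtain ⟨_, ⟨i, rfl⟩, _, ⟨j, rfl⟩, rfl⟩ := hz
      exact hy i j
    | zero => exact inner_zero_left _
    | add z z' _ _ h h' => rw [inner_add_left, h, h', add_zero]
    | smul c z _ h => rw [real_inner_smul_left, h, mul_zero]

/-- The facet normals of a simplex with given vertices. -/
theorem exists_isSimplexPair_of_vertices {ι : Type*} [Fintype ι] [Nonempty ι]
    {v : ι → Space k} (hv : AffineIndependent ℝ v) :
    ∃ (u : ι → Space k) (b : ι → ℝ), IsSimplexPair u v b := by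
  choose g c hgc using fun i : ι => exists_inner_add_const_eq hv fun j => if i = j then 1 else 0
  obtain ⟨o⟩ := ‹Nonempty ι›
  set D := (affineSpan ℝ (Set.range v)).direction with hD
  -- Outer normals are minus the gradients of the barycentric coordinates, projected to the
  -- direction of the simplex.
  set u : ι → Space k := fun i => -D.starProjection (g i) with hu
  have huD : ∀ i, u i ∈ D := fun i => D.neg_mem (Submodule.starProjection_apply_mem _ _)
  have hinner : ∀ i, ∀ z ∈ D, inner ℝ (u i) z = -inner ℝ (g i) z := by
    intro i z hz
    rw [hu, inner_neg_left, Submodule.inner_starProjection_left_eq_right,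
      Submodule.starProjection_eq_self_iff.2 hz]
  obtain ⟨b, hb⟩ : ∃ b : ι → ℝ, ∀ i j, inner ℝ (u i) (v j) = b i - if i = j then 1 else 0 := by
    refine ⟨fun i => c i + inner ℝ (g i) (v o) + inner ℝ (u i) (v o), fun i j => ?_⟩
    have h1 := hinner i _ (sub_mem_direction_range v j o)
    rw [inner_sub_right, inner_sub_right] at h1
    have h2 := hgc i j
    linarith
  have hsum : ∀ j, inner ℝ (∑ i, u i) (v j) = ∑ i, b i - 1 := by
    intro j
    simp only [sum_inner, hb, Finset.sum_sub_distrib, Finset.sum_ite_eq', Finset.mem_univ,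
      if_true]
  have hsum0 : ∑ i, u i = 0 := by
    have h1 : ∑ i, u i ∈ Dᗮ := by
      rw [mem_orthogonal_direction_range_iff]
      intro i j
      rw [real_inner_comm, inner_sub_right, hsum, hsum, sub_self]
    exact inner_self_eq_zero.1
      ((Submodule.mem_orthogonal _ _).1 h1 _ (D.sum_mem fun i _ => huD i))
  refine ⟨u, b, hsum0, ?_, hb, fun y => ⟨fun hy i => ?_, fun hy => ?_⟩⟩
  · have := hsum o
    rw [hsum0, inner_zero_left] at this
    linarith
  · exact (Submodule.mem_orthogonal _ _).1 hy _ (huD i)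
  · have hrec : ∀ z ∈ D, z = -∑ i, inner ℝ (u i) z • v i := by
      intro z hz
      rw [hD, direction_affineSpan, vectorSpan_def] at hz
      induction hz using Submodule.span_induction with
      | mem z hz =>
        obtain ⟨_, ⟨i, rfl⟩, _, ⟨j, rfl⟩, rfl⟩ := hz
        simp [inner_sub_right, hb, sub_smul, Finset.sum_sub_distrib]
      | zero => simp
      | add z z' _ _ h h' =>
        simp only [inner_add_right, add_smul, Finset.sum_add_distrib, neg_add]
        rw [← h, ← h']
      | smul c z _ h =>
        simp only [real_inner_smul_right, mul_smul, ← Finset.smul_sum, ← smul_neg]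
        rw [← h]
    have hp : D.starProjection y = 0 := by
      rw [hrec _ (Submodule.starProjection_apply_mem D y), neg_eq_zero]
      refine Finset.sum_eq_zero fun i _ => ?_
      rw [← Submodule.inner_starProjection_left_eq_right,
        Submodule.starProjection_eq_self_iff.2 (huD i), hy, zero_smul]
    rwa [Submodule.starProjection_apply_eq_zero_iff] at hp

/-- The simplex with given unit facet normals and facet volumes. -/
theorem exists_isSimplexPair_of_normals {ι : Type*} [Fintype ι] [Nonempty ι]
    {x : ι → Space k} (hx : AffineIndependent ℝ x) {w : ι → ℝ} (hw : ∀ i, 0 < w i)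
    (hwx : ∑ i, w i • x i = 0) :
    ∃ (v : ι → Space k) (b : ι → ℝ), IsSimplexPair (fun i => w i • x i) v b ∧ ∀ i, 0 < b i := by
  have hW : 0 < ∑ i, w i := Finset.sum_pos (fun i _ => hw i) Finset.univ_nonempty
  -- Only positivity and sum one matter here; other such offsets would merely translate the simplex.
  set b : ι → ℝ := fun i => w i / ∑ i, w i with hb
  have hb1 : ∑ i, b i = 1 := by
    rw [hb, ← Finset.sum_div, div_self hW.ne']
  set u : ι → Space k := fun i => w i • x i with hu
  set L := Submodule.span ℝ (Set.range u) with hL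
  have huL : ∀ i, u i ∈ L := fun i => Submodule.subset_span ⟨i, rfl⟩
  have hsolve : ∀ j, ∃ v ∈ L, ∀ i, inner ℝ (u i) v = b i - if i = j then 1 else 0 := by
    intro j
    obtain ⟨g, c, hgc⟩ := exists_inner_add_const_eq hx
      fun i => (b i - if i = j then 1 else 0) / w i
    have h1 : ∀ i, inner ℝ (u i) g + c * w i = b i - if i = j then 1 else 0 := by
      intro i
      rw [hu, real_inner_smul_left, real_inner_comm]
      have h2 := hgc i
      rw [eq_div_iff (hw i).ne'] at h2
      linarith
    have hc : c = 0 := by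
      have h2 := Finset.sum_congr rfl fun i (_ : i ∈ Finset.univ) => h1 i
      rw [Finset.sum_add_distrib, ← sum_inner, hwx, inner_zero_left, zero_add, ← Finset.mul_sum,
        Finset.sum_sub_distrib, hb1, Finset.sum_ite_eq', if_pos (Finset.mem_univ _), sub_self]
        at h2
      exact (mul_eq_zero.1 h2).resolve_right hW.ne'
    -- Vertices are taken in the span of the normals, so that directions orthogonal to the normals
    -- are orthogonal to the simplex.
    refine ⟨L.starProjection g, Submodule.starProjection_apply_mem _ _, fun i => ?_⟩
    rw [← h1 i, hc, zero_mul, add_zero, ← Submodule.inner_starProjection_left_eq_right,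
      Submodule.starProjection_eq_self_iff.2 (huL i)]
  choose v hvL hv using hsolve
  have horth : ∀ y, y ∈ Lᗮ ↔ ∀ i, inner ℝ (u i) y = 0 := by
    intro y
    rw [Submodule.mem_orthogonal]
    refine ⟨fun h i => h _ (huL i), fun h z hz => ?_⟩
    induction hz using Submodule.span_induction with
    | mem z hz =>
      obtain ⟨i, rfl⟩ := hz
      exact h i
    | zero => exact inner_zero_left _
    | add z z' _ _ h h' => rw [inner_add_left, h, h', add_zero]
    | smul c z _ h => rw [real_inner_smul_left, h, mul_zero]
  refine ⟨v, b, ⟨hwx, hb1, fun i j => hv j i, fun y => ?_⟩, fun i => div_pos (hw i) hW⟩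
  rw [mem_orthogonal_direction_range_iff]
  constructor
  · intro hy
    obtain ⟨a, ha⟩ := (Submodule.mem_span_range_iff_exists_fun ℝ).1
      (Submodule.starProjection_apply_mem L y)
    have h1 : ∀ j, inner ℝ (v j) y = ∑ i, a i * b i - a j := by
      intro j
      rw [← Submodule.starProjection_eq_self_iff.2 (hvL j),
        Submodule.inner_starProjection_left_eq_right, ← ha, real_inner_comm, sum_inner]
      simp only [real_inner_smul_left, hv, mul_sub, Finset.sum_sub_distrib, mul_ite, mul_one,
        mul_zero, Finset.sum_ite_eq', Finset.mem_univ, if_true]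
    obtain ⟨o⟩ := ‹Nonempty ι›
    -- Constant coefficients make the projection of `y` a multiple of `∑ i, u i = 0`.
    have h2 : ∀ j, a j = a o := by
      intro j
      have := hy j o
      rw [inner_sub_left, h1, h1] at this
      linarith
    have h3 : L.starProjection y = 0 := by
      rw [← ha]
      simp only [h2, ← Finset.smul_sum]
      rw [hwx, smul_zero]
    exact (horth y).1 ((Submodule.starProjection_apply_eq_zero_iff L).1 h3)
  · intro hy i j
    exact (Submodule.mem_orthogonal _ _).1 ((horth y).2 hy) _ (L.sub_mem (hvL i) (hvL j))

/-! ### Representing measures of simplices -/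

theorem IsSimplexPair.exists_represents {ι : Type*} [Fintype ι] {u v : ι → Space k} {b : ι → ℝ}
    (h : IsSimplexPair u v b) (hu : ∀ i, u i ≠ 0) {δ : Finset (Space k) → ℝ}
    (hδ : ∀ A : Finset (Space k), A.Nonempty →
      δ A = ∑ i, supportFun (A : Set (Space k)) (u i)) :
    ∃ ν : Measure (UnitSphere k), IsFiniteMeasure ν ∧ Represents ν δ ∧
      (supportSet ν).Finite ∧ IsAffinelyIndependentSet (supportSet ν) := by
  have hn : ∀ i, ‖u i‖ ≠ 0 := fun i => norm_ne_zero_iff.2 (hu i)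
  let x : ι → UnitSphere k := fun i => ⟨‖u i‖⁻¹ • u i, by simp [norm_smul, hn i]⟩
  let ν : Measure (UnitSphere k) := ∑ i, ENNReal.ofReal ‖u i‖ • Measure.dirac (x i)
  have hfin : ∀ i, IsFiniteMeasure (ENNReal.ofReal ‖u i‖ • Measure.dirac (x i)) := fun i =>
    Measure.smul_finite _ ENNReal.ofReal_ne_top
  have hνfin : IsFiniteMeasure ν := inferInstance
  have hint {E : Type} [NormedAddCommGroup E] [NormedSpace ℝ E] [CompleteSpace E]
      (F : UnitSphere k → E) (hF : Continuous F) : ∫ y, F y ∂ν = ∑ i, ‖u i‖ • F (x i) := by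
    rw [integral_finsetSum_measure fun i _ => integrable_of_continuous _ hF]
    refine Finset.sum_congr rfl fun i _ => ?_
    rw [integral_smul_measure, integral_dirac, ENNReal.toReal_ofReal (norm_nonneg _)]
  have hsupp : ν.support ⊆ Set.range x := by
    refine Measure.support_subset_of_isClosed (Set.finite_range x).isClosed ?_
    rw [mem_ae_iff, Measure.finsetSum_apply]
    refine Finset.sum_eq_zero fun i _ => ?_
    rw [Measure.smul_apply, Measure.dirac_apply' _ (Set.finite_range x).measurableSet.compl]
    simp
  have hsub : supportSet ν ⊆ Set.range fun i => ‖u i‖⁻¹ • u i := by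
    rintro _ ⟨y, hy, rfl⟩
    obtain ⟨i, rfl⟩ := hsupp hy
    exact ⟨i, rfl⟩
  refine ⟨ν, hνfin, ⟨?_, fun A hA => ?_⟩, (Set.finite_range _).subset hsub,
    (h.affineIndependent_unit_normals hu).range.mono hsub⟩
  · rw [hint _ continuous_subtype_val]
    exact (Finset.sum_congr rfl fun i _ => smul_inv_smul₀ (hn i) _).trans h.sum_normal
  · rw [hδ A hA]
    refine Eq.trans (Finset.sum_congr rfl fun i _ => ?_)
      (hint _ ((continuous_supportFun hA).comp continuous_subtype_val)).symm
    rw [smul_eq_mul, Function.comp_apply, ← supportFun_smul_right hA (norm_nonneg _),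
      smul_inv_smul₀ (hn i)]

theorem IsMinkowskiSemidiversity.exists_represents {W : Set (Space k)}
    (hW : IsAffinelyIndependentSet W) {δ : Finset (Space k) → ℝ} (h0 : δ ∅ = 0) (hδ0 : δ ≠ 0)
    (hδ : IsMinkowskiSemidiversity (simplexKernel W) δ) :
    ∃ ν : Measure (UnitSphere k), IsFiniteMeasure ν ∧ Represents ν δ ∧
      (supportSet ν).Finite ∧ IsAffinelyIndependentSet (supportSet ν) := by
  have hne : Nonempty W := by
    obtain ⟨_, p, hp, -⟩ := hδ.interior_nonempty.mono interior_subset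
    exact (convexHull_nonempty_iff.1 ⟨p, hp⟩).to_subtype
  have hWfin : W.Finite := finite_set_of_fin_dim_affineIndependent ℝ hW
  have := hWfin.fintype
  obtain ⟨u, b, h⟩ := exists_isSimplexPair_of_vertices hW
  have hsum : ∀ A : Finset (Space k), A.Nonempty →
      δ A = ∑ i, supportFun (A : Set (Space k)) (u i) := fun A hA => by
    rw [hδ.eq_genCircumradius, ← h.genCircumradius_eq_sum hA, Subtype.range_coe]
  -- A zero normal occurs only for a one-point `W`, whose kernel is the whole space and gives `δ =
  -- 0`.
  refine h.exists_represents (fun i hi => hδ0 (funext fun A => ?_)) hsum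
  rcases A.eq_empty_or_nonempty with rfl | hA
  · exact h0
  · rw [hsum A hA]
    refine Finset.sum_eq_zero fun j _ => ?_
    rw [h.eq_of_normal_eq_zero hi j, hi]
    simpa using supportFun_smul_right hA le_rfl (0 : Space k)

theorem Represents.exists_isMinkowskiSemidiversity {δ : Finset (Space k) → ℝ}
    {ν : Measure (UnitSphere k)} [IsFiniteMeasure ν] (h : Represents ν δ) (h0 : δ ∅ = 0)
    (hδ : δ ≠ 0) (hfin : ν.support.Finite) (hind : IsAffinelyIndependentSet (supportSet ν)) :
    ∃ W : Set (Space k), IsAffinelyIndependentSet W ∧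
      IsMinkowskiSemidiversity (simplexKernel W) δ := by
  have hν0 : ν ≠ 0 := by
    rintro rfl
    simpa using h.measureReal_univ_pos h0 hδ
  have := hfin.fintype
  have hne : Nonempty ν.support := (Measure.nonempty_support hν0).to_subtype
  have hsum {E : Type} [NormedAddCommGroup E] [NormedSpace ℝ E] [CompleteSpace E]
      (F : UnitSphere k → E) (hF : Continuous F) :
      ∫ y, F y ∂ν = ∑ i : ν.support, ν.real {(i : UnitSphere k)} • F i := by
    rw [integral_eq_sum_of_finite_support hfin Measure.measure_compl_support hF]
    exact (Finset.sum_subtype hfin.toFinset (fun _ => hfin.mem_toFinset) _)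
  rw [isAffinelyIndependentSet_supportSet_iff] at hind
  obtain ⟨v, b, hvb, hb⟩ := exists_isSimplexPair_of_normals hind
    (w := fun i => ν.real {(i : UnitSphere k)})
    (fun i => ENNReal.toReal_pos (measure_singleton_pos_of_finite_support hfin i.2).ne'
      (measure_ne_top _ _))
    ((hsum _ continuous_subtype_val).symm.trans h.centroid_eq_zero)
  refine ⟨Set.range v, hvb.affineIndependent_vertices.range,
    hvb.isMinkowskiSemidiversity hb h0 fun A hA => ?_⟩
  rw [h.eq_integral A hA]
  refine (hsum _ ((continuous_supportFun hA).comp continuous_subtype_val)).trans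
    (Finset.sum_congr rfl fun i _ => ?_)
  rw [supportFun_smul_right hA measureReal_nonneg]
  rfl

end Classical

end LinearDiversity

/-! ### The equivalence, through representing measures -/

theorem mainTheorem2 (k : ℕ) (δ : Finset (LinearDiversity.Space k) → ℝ)
    (hδ : LinearDiversity.IsSemidiversity δ) (hδ0 : δ ≠ 0) :
    List.TFAE [
      LinearDiversity.IsExtremalLinear δ,
      ∃ ν : MeasureTheory.Measure (LinearDiversity.UnitSphere k),
        MeasureTheory.IsFiniteMeasure ν ∧
        LinearDiversity.Represents ν δ ∧
        (LinearDiversity.supportSet ν).Finite ∧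
        LinearDiversity.IsAffinelyIndependentSet (LinearDiversity.supportSet ν),
      ∃ W : Set (LinearDiversity.Space k),
        LinearDiversity.IsAffinelyIndependentSet W ∧
        LinearDiversity.IsMinkowskiSemidiversity (LinearDiversity.simplexKernel W) δ] := by
  have h0 := hδ.apply_empty
  tfae_have 1 → 2 := fun h => by
    obtain ⟨ν, _, hν⟩ := h.isLinearSemidiversity.exists_represents
    exact ⟨ν, inferInstance, hν, (h.finite_support hν).image _,
      h.isAffinelyIndependentSet_supportSet hν⟩
  tfae_have 2 → 1 := fun ⟨ν, _, hν, hfin, hind⟩ =>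
    hν.isExtremalLinear h0 hδ0 (hfin.of_finite_image Subtype.val_injective.injOn) hind
  tfae_have 2 → 3 := fun ⟨ν, _, hν, hfin, hind⟩ =>
    hν.exists_isMinkowskiSemidiversity h0 hδ0 (hfin.of_finite_image Subtype.val_injective.injOn)
      hind
  tfae_have 3 → 2 := fun ⟨_, hW, hK⟩ => hK.exists_represents hW h0 hδ0
  tfae_finish
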